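/- **Setting.** Let $\mathbb H$ be the quaternions and let $\Omega^1$ be the first order differential calculus on $\mathbb H$ that is free as a left module on $di, dj$ and satisfies $dk=-j\,di+i\,dj$ (the maximal $\{i,j\}$-terminal calculus). Thus $di\,h=(khk^{-1})\,di$, $dj\,h=(khk^{-1})\,dj$, and $dh=\partial_i(h)\,di+\partial_j(h)\,dj$ with $\partial_i h=h_i-h_kj$, $\partial_j h=h_j+h_ki$ for $h=h_1+h_ii+h_jj+h_kk$. Equip it with the maximal exterior algebra, so that $\Omega^2$ is the quotient of $\Omega^1\otimes_{\mathbb H}\Omega^1$ by the left submodule generated by all $\sum_r da_r\otimes db_r$ with $\sum_r a_r\,db_r=0$, and put $S^2=\ker(\wedge:\Omega^1\otimes_{\mathbb H}\Omega^1\to\Omega^2)$. *Jets, operators, symbols.* $J^0\mathbb H=\mathbb H$; $J^1E$ is the extension of $E$ by $\Omega^1\otimes_{\mathbb H}E$ with prolongation $j^1$ and $j^1(ae)=a\,j^1(e)+\iota^1(da\otimes e)$; $J^2E\subseteq J^1J^1E$ consists of the elements whose two projections to $J^1E$ agree and which the Spencer operators send to $0$ in $\Omega^2\otimes_{\mathbb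 H}E$; and $J^{n+2}\mathbb H=J^1(J^{n+1}\mathbb H)\cap J^2(J^n\mathbb H)$. $\mathrm{Diff}^n$ is the space of maps $\Delta=\tilde\Delta\circ j^n:\mathbb H\to\mathbb H$ with $\tilde\Delta:J^n\mathbb H\to\mathbb H$ left $\mathbb H$-linear, $\mathrm{Symb}^n=\mathrm{Diff}^n/\mathrm{Diff}^{n-1}$ with quotient map $\varsigma^n$, and $\mathrm{Symb}^\bullet=\bigoplus_n\mathrm{Symb}^n$ with the product $\cdot$ induced by composition and unit $1=\varsigma^0(\mathrm{id})$. *Quantization.* A full quantization is a family of linear sections $q^n:\mathrm{Symb}^n\to\mathrm{Diff}^n$ of $\varsigma^n$ compatible with composition on the left with left $\mathbb H$-linear maps $\mathbb H\to\mathbb H$. Let $\nabla$ be the flat Levi-Civita bimodule connection $\nabla(a\,di+b\,dj)=da\otimes di+db\otimes dj$ of the metric $g=di\otimes dj-dj\otimes di$. Its generalized braiding is the $\mathbb H$-bimodule map $\sigma$ with $\sigma(\omega\otimes\nu)=-\nu\otimes\omega$ for $\omega,\nu\in\{di,dj\}$. Put $s^{1,1}=\tfrac12(\mathrm{id}+\sigma):\Omega^1\otimes_{\mathbb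 H}\Omega^1\to S^2$. The quantization $q$ induced by $\nabla$ and $s^{1,1}$ is given by $$q^0=\mathrm{id},\qquad q^1(\varsigma^1(\Delta))=\tilde\Delta\circ\iota^1\circ d,\qquad q^2(\varsigma^2(\Delta))=\tilde\Delta\circ\iota^2\circ s^{1,1}\circ\nabla\circ d,\qquad q^n=0\ (n\ge3),$$ where $\iota^1:\Omega^1\to J^1\mathbb H$ and $\iota^2:S^2\to J^2\mathbb H$ are the canonical inclusions. *Star product.* Every $\Delta\in\mathrm{Diff}^N$ is uniquely $\sum_{l\le N}q^l(\Delta_l)$ with $\Delta_l\in\mathrm{Symb}^l$. For $\hbar\in\mathbb R$, the star product is the bilinear product on $\mathrm{Symb}^\bullet$ with $\sigma\star\tau=\sum_{k=0}^{n+m}\hbar^k\,\big(q^n(\sigma)\circ q^m(\tau)\big)_{n+m-k}$ for $\sigma\in\mathrm{Symb}^n$, $\tau\in\mathrm{Symb}^m$. Finally let $x_a=\varsigma^0(R_a)$, where $R_a(h)=ha$, and $p_a=\varsigma^1(\partial_a)$ for $a\in\{i,j\}$. The subalgebra generated by a set is the smallest subspace containing that set and $1$ and closed under the product. **Proposition 5.53.**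 The full quantization $q$ just described exists and is unique. For every $\hbar\in\mathbb R$ its star product satisfies, for all $a,b\in\{i,j\}$, $$x_a\star x_b=x_a\cdot x_b,\qquad p_a\star x_b=-x_b\cdot p_a+\hbar\,\delta_{a,b},\qquad x_a\star p_b=x_a\cdot p_b,\qquad p_a\star p_b=p_a\cdot p_b,$$ and $x_i,x_j,p_i,p_j$ generate $(\mathrm{Symb}^\bullet,\star)$. Moreover, for every $\hbar$, $x_i$ and $x_j$ generate a subalgebra of $(\mathrm{Symb}^\bullet,\star)$ isomorphic to $\mathbb H^{\mathrm{op}}$, and $p_i\star p_j=-p_j\star p_i$, $p_i\star p_i=p_j\star p_j=0$. The subalgebra generated by $x_i,x_j$ and the one generated by $p_i,p_j$, with their products, do not depend on $\hbar$. For $\hbar=0$ the star product is the product of the symbol algebra. -/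

import Mathlib

noncomputable section

open scoped TensorProduct

namespace QuatQuant

/-- The algebra `ℍ` of real quaternions. -/
abbrev QH : Type := Quaternion ℝ

/-- The quaternion `a + b i + c j + e k`. -/
def quat (a b c e : ℝ) : QH := ⟨a, b, c, e⟩

@[simp] theorem quat_re (a b c e : ℝ) : (quat a b c e).re = a := rfl
@[simp] theorem quat_imI (a b c e : ℝ) : (quat a b c e).imI = b := rfl
@[simp] theorem quat_imJ (a b c e : ℝ) : (quat a b c e).imJ = c := rfl
@[simp] theorem quat_imK (a b c e : ℝ) : (quat a b c e).imK = e := rfl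

@[simp] theorem one_re : (1 : QH).re = 1 := rfl
@[simp] theorem one_imI : (1 : QH).imI = 0 := rfl
@[simp] theorem one_imJ : (1 : QH).imJ = 0 := rfl
@[simp] theorem one_imK : (1 : QH).imK = 0 := rfl
@[simp] theorem zero_re : (0 : QH).re = 0 := rfl
@[simp] theorem zero_imI : (0 : QH).imI = 0 := rfl
@[simp] theorem zero_imJ : (0 : QH).imJ = 0 := rfl
@[simp] theorem zero_imK : (0 : QH).imK = 0 := rfl

/-- The quaternion units. -/
def qi : QH := quat 0 1 0 0
def qj : QH := quat 0 0 1 0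
def qk : QH := quat 0 0 0 1

/-- Conjugation by `k`, i.e. `h ↦ k h k⁻¹`, which fixes `1, k` and negates `i, j`. It is the
automorphism of `ℍ` through which the right module structure acts on the frame `di, dj`. -/
def twist : QH →+* QH where
  toFun h := quat h.re (-h.imI) (-h.imJ) h.imK
  map_one' := by apply Quaternion.ext <;> simp
  map_mul' a b := by apply Quaternion.ext <;> simp <;> ring_nf
  map_zero' := by apply Quaternion.ext <;> simp
  map_add' a b := by apply Quaternion.ext <;> simp <;> ring_nf

/-- The bimodule `Ω¹` of one-forms of the maximal `{i,j}`-terminal first order calculus on `ℍ`: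
the left module freely generated by `di` and `dj`, the pair `(a, b)` standing for `a di + b dj`.
The right action is `di h = (k h k⁻¹) di`, `dj h = (k h k⁻¹) dj` (an `ℍᵐᵒᵖ`-module structure).
This is the bimodule structure forced by `dk = -j di + i dj` and the Leibniz rule. -/
def Om : Type := QH × QH

instance : AddCommGroup Om := inferInstanceAs (AddCommGroup (QH × QH))
instance : Module QH Om := inferInstanceAs (Module QH (QH × QH))
instance : Module QHᵐᵒᵖ Om := Module.compHom (QH × QH) (RingHom.op twist)

/-- The form `a di + b dj`. -/
def Om.mk (a b : QH) : Om := ((a, b) : QH × QH)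

/-- The coefficient of `di` (left linear). -/
def Om.ci : Om →ₗ[QH] QH := LinearMap.fst QH QH QH

/-- The coefficient of `dj` (left linear). -/
def Om.cj : Om →ₗ[QH] QH := LinearMap.snd QH QH QH

@[ext] theorem Om.ext {v w : Om} (h1 : v.ci = w.ci) (h2 : v.cj = w.cj) : v = w := Prod.ext h1 h2
@[simp] theorem Om.ci_mk (a b : QH) : (Om.mk a b).ci = a := rfl
@[simp] theorem Om.cj_mk (a b : QH) : (Om.mk a b).cj = b := rfl
@[simp] theorem Om.ci_op (c : QH) (w : Om) : (MulOpposite.op c • w).ci = w.ci * twist c := rfl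
@[simp] theorem Om.cj_op (c : QH) (w : Om) : (MulOpposite.op c • w).cj = w.cj * twist c := rfl

instance : SMulCommClass QH QHᵐᵒᵖ Om where
  smul_comm a c w := by
    induction c using MulOpposite.rec' with
    | _ c => ext1 <;> simp [mul_assoc]

instance : SMulCommClass QHᵐᵒᵖ QH Om := SMulCommClass.symm _ _ _

/-- The frame `di, dj` (see `d_qi`, `d_qj`). -/
def di : Om := Om.mk 1 0
def dj : Om := Om.mk 0 1

/-- The operator `∂_i`, determined by `dh = (∂_i h) di + (∂_j h) dj`: for
`h = h₁ + h_i i + h_j j + h_k k` it is `∂_i h = h_i - h_k j`. -/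
def partialI : QH →ₗ[ℝ] QH where
  toFun h := quat h.imI 0 (-h.imK) 0
  map_add' a b := by apply Quaternion.ext <;> simp <;> ring_nf
  map_smul' c a := by apply Quaternion.ext <;> simp

/-- The operator `∂_j`, determined by `dh = (∂_i h) di + (∂_j h) dj`: for
`h = h₁ + h_i i + h_j j + h_k k` it is `∂_j h = h_j + h_k i`. -/
def partialJ : QH →ₗ[ℝ] QH where
  toFun h := quat h.imJ h.imK 0 0
  map_add' a b := by apply Quaternion.ext <;> simp
  map_smul' c a := by apply Quaternion.ext <;> simp

theorem twist_apply (h : QH) : twist h = quat h.re (-h.imI) (-h.imJ) h.imK := rfl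
theorem partialI_apply (h : QH) : partialI h = quat h.imI 0 (-h.imK) 0 := rfl
theorem partialJ_apply (h : QH) : partialJ h = quat h.imJ h.imK 0 0 := rfl

theorem partialI_mul (a b : QH) : partialI (a * b) = a * partialI b + partialI a * twist b := by
  apply Quaternion.ext <;> simp [partialI_apply, twist_apply] <;> ring
theorem partialJ_mul (a b : QH) : partialJ (a * b) = a * partialJ b + partialJ a * twist b := by
  apply Quaternion.ext <;> simp [partialJ_apply, twist_apply] <;> ring

/-- The differential `d : ℍ → Ω¹`. It satisfies the Leibniz rule (`d_mul`) and the structure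
equation `dk = -j di + i dj` (`d_qk`). -/
def d : QH →+ Om where
  toFun h := Om.mk (partialI h) (partialJ h)
  map_zero' := by ext1 <;> simp
  map_add' a b := by ext1 <;> simp

@[simp] theorem ci_d (h : QH) : (d h).ci = partialI h := rfl
@[simp] theorem cj_d (h : QH) : (d h).cj = partialJ h := rfl

theorem d_qi : d qi = di := by
  ext1 <;> apply Quaternion.ext <;> simp [di, partialI_apply, partialJ_apply, qi]
theorem d_qj : d qj = dj := by
  ext1 <;> apply Quaternion.ext <;> simp [dj, partialI_apply, partialJ_apply, qj]
theorem d_qk : d qk = -(qj • di) + qi • dj := by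
  ext1 <;> apply Quaternion.ext <;> simp [di, dj, partialI_apply, partialJ_apply, qi, qj, qk]
theorem d_one : d 1 = 0 := by
  ext1 <;> apply Quaternion.ext <;> simp [partialI_apply, partialJ_apply]

theorem d_mul (a b : QH) : d (a * b) = MulOpposite.op b • d a + a • d b := by
  ext1 <;> simp [partialI_mul, partialJ_mul, add_comm]

theorem Om.eq_comb (w : Om) : w = w.ci • di + w.cj • dj := by
  ext1 <;> simp [di, dj]

section Tensor

variable (E : Type) [AddCommGroup E] [Module QH E]

/-- The relations `(w c) ⊗ e - w ⊗ (c e)` of the tensor product over `ℍ`. -/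
def balance : Submodule QH (Om ⊗[ℤ] E) :=
  Submodule.span QH {t | ∃ (w : Om) (c : QH) (e : E),
    t = (MulOpposite.op c • w) ⊗ₜ[ℤ] e - w ⊗ₜ[ℤ] (c • e)}

/-- The tensor product `Ω¹ ⊗_ℍ E`, a left `ℍ`-module through the left action on `Ω¹`.
In particular `Ω¹ ⊗_ℍ Ω¹` is `OmT Om`, and `Ω¹ ⊗_ℍ (Ω¹ ⊗_ℍ E)` is `OmT (OmT E)`. -/
def OmT : Type := (Om ⊗[ℤ] E) ⧸ balance E

instance : AddCommGroup (OmT E) := inferInstanceAs (AddCommGroup (_ ⧸ balance E))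
instance : Module QH (OmT E) := inferInstanceAs (Module QH (_ ⧸ balance E))

end Tensor

namespace OmT

variable {E F G : Type} [AddCommGroup E] [Module QH E] [AddCommGroup F] [Module QH F]
  [AddCommGroup G]

/-- The elementary tensor `w ⊗ e`. -/
def tmul (w : Om) (e : E) : OmT E := (balance E).mkQ (w ⊗ₜ[ℤ] e)

theorem tmul_add (w : Om) (e f : E) : tmul w (e + f) = tmul w e + tmul w f := by
  simp only [tmul, TensorProduct.tmul_add, map_add]; rfl

theorem add_tmul (v w : Om) (e : E) : tmul (v + w) e = tmul v e + tmul w e := by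
  simp only [tmul, TensorProduct.add_tmul, map_add]; rfl

theorem smul_tmul (a : QH) (w : Om) (e : E) : tmul (a • w) e = a • tmul w e := rfl

theorem op_smul_tmul (c : QH) (w : Om) (e : E) :
    tmul (MulOpposite.op c • w) e = tmul w (c • e) :=
  (Submodule.Quotient.eq _).2 (Submodule.subset_span ⟨w, c, e, rfl⟩)

/-- The map `e ↦ w ⊗ e`. -/
def tmulHom (w : Om) : E →+ OmT E := AddMonoidHom.mk' (tmul w) (tmul_add w)

theorem tmul_zero (w : Om) : tmul w (0 : E) = 0 := (tmulHom w).map_zero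
theorem tmul_neg (w : Om) (e : E) : tmul w (-e) = -tmul w e := (tmulHom w).map_neg e
theorem tmul_sub (w : Om) (e f : E) : tmul w (e - f) = tmul w e - tmul w f :=
  (tmulHom w).map_sub e f

/-- The map `w ↦ w ⊗ e`. -/
def tmulHom' (e : E) : Om →+ OmT E := AddMonoidHom.mk' (fun w => tmul w e) fun v w => add_tmul v w e

theorem zero_tmul (e : E) : tmul 0 e = 0 := (tmulHom' e).map_zero
theorem neg_tmul (w : Om) (e : E) : tmul (-w) e = -tmul w e := (tmulHom' e).map_neg w

@[elab_as_elim]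
theorem induction {p : OmT E → Prop} (zero : p 0) (tmul : ∀ w e, p (tmul w e))
    (add : ∀ s t, p s → p t → p (s + t)) (t : OmT E) : p t := by
  obtain ⟨t, rfl⟩ := Submodule.mkQ_surjective _ t
  induction t using TensorProduct.induction_on with
  | zero => rw [map_zero]; exact zero
  | tmul w e => exact tmul w e
  | add s t hs ht => rw [map_add]; exact add _ _ hs ht

/-- The additive map out of `Ω¹ ⊗_ℍ E` induced by a balanced biadditive map. -/
def liftAdd (f : Om →+ E →+ G)
    (hf : ∀ (w : Om) (c : QH) (e : E), f (MulOpposite.op c • w) e = f w (c • e)) :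
    OmT E →+ G :=
  QuotientAddGroup.lift (balance E).toAddSubgroup
    (TensorProduct.liftAddHom f (by intro r w e; simp)) (by
      intro t ht
      change t ∈ balance E at ht
      have key : ∀ a : QH, TensorProduct.liftAddHom f (by intro r w e; simp) (a • t) = 0 := by
        induction ht using Submodule.span_induction with
        | mem t ht =>
          obtain ⟨w, c, e, rfl⟩ := ht
          intro a
          rw [smul_sub, map_sub, TensorProduct.smul_tmul', TensorProduct.smul_tmul',
            TensorProduct.liftAddHom_tmul, TensorProduct.liftAddHom_tmul,
            smul_comm a (MulOpposite.op c) w, hf, sub_self]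
        | zero => intro a; rw [smul_zero, map_zero]
        | add s t _ _ hs ht => intro a; rw [smul_add, map_add, hs, ht, add_zero]
        | smul b t _ ht => intro a; rw [smul_smul]; exact ht _
      simpa using key 1)

@[simp] theorem liftAdd_tmul (f : Om →+ E →+ G)
    (hf : ∀ (w : Om) (c : QH) (e : E), f (MulOpposite.op c • w) e = f w (c • e))
    (w : Om) (e : E) : liftAdd f hf (tmul w e) = f w e := rfl

variable [Module QH G]

/-- The left linear map out of `Ω¹ ⊗_ℍ E` induced by a balanced biadditive map that is left
linear in the form. -/
def lift (f : Om →+ E →+ G)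
    (hf : ∀ (w : Om) (c : QH) (e : E), f (MulOpposite.op c • w) e = f w (c • e))
    (hs : ∀ (a : QH) (w : Om) (e : E), f (a • w) e = a • f w e) : OmT E →ₗ[QH] G where
  toFun := liftAdd f hf
  map_add' := map_add _
  map_smul' a t := by
    induction t using OmT.induction with
    | zero => simp
    | tmul w e => rw [← smul_tmul]; exact hs a w e
    | add s t h1 h2 => rw [smul_add, map_add, h1, h2, map_add, smul_add]

@[simp] theorem lift_tmul (f : Om →+ E →+ G)
    (hf : ∀ (w : Om) (c : QH) (e : E), f (MulOpposite.op c • w) e = f w (c • e))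
    (hs : ∀ (a : QH) (w : Om) (e : E), f (a • w) e = a • f w e) (w : Om) (e : E) :
    lift f hf hs (tmul w e) = f w e := rfl

theorem hom_ext {M : Type} [AddCommGroup M] {f g : OmT E →+ M}
    (h : ∀ w e, f (tmul w e) = g (tmul w e)) : f = g := by
  ext t
  induction t using OmT.induction with
  | zero => simp
  | tmul w e => exact h w e
  | add s t h1 h2 => rw [map_add, h1, h2, map_add]

/-- The universal balanced map `(w, e) ↦ w ⊗ e`. -/
def tmulBi (E : Type) [AddCommGroup E] [Module QH E] : Om →+ E →+ OmT E :=
  AddMonoidHom.mk' tmulHom fun v w => by ext e; exact add_tmul v w e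

@[simp] theorem tmulBi_apply (w : Om) (e : E) : tmulBi E w e = tmul w e := rfl

/-- The map `id ⊗ f : Ω¹ ⊗_ℍ E → Ω¹ ⊗_ℍ F` for a left linear `f`. -/
def map (f : E →ₗ[QH] F) : OmT E →ₗ[QH] OmT F :=
  lift ((AddMonoidHom.compHom' f.toAddMonoidHom).comp (tmulBi F))
    (fun w c e => by simp [op_smul_tmul]) (fun a w e => by simp [smul_tmul])

@[simp] theorem map_tmul (f : E →ₗ[QH] F) (w : Om) (e : E) : map f (tmul w e) = tmul w (f e) := rfl

theorem map_map (g : F →ₗ[QH] G) (f : E →ₗ[QH] F) (t : OmT E) :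
    map g (map f t) = map (g ∘ₗ f) t := by
  induction t using OmT.induction with
  | zero => simp
  | tmul w e => rfl
  | add s t h1 h2 => simp only [map_add, h1, h2]


end OmT

section Jet

variable (E F : Type) [AddCommGroup E] [Module QH E] [AddCommGroup F] [Module QH F]

/-- The kernel of `Ω¹ ⊗ Ω¹ ⊗ E → Ω² ⊗ E`, where `Ω²` belongs to the maximal exterior algebra:
it is generated by the elements `∑ da_r ⊗ db_r ⊗ e` with `∑ a_r db_r = 0`. -/
def rel2 : Submodule QH (OmT (OmT E)) :=
  Submodule.span QH {t | ∃ (n : ℕ) (a b : Fin n → QH) (e : E),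
    ∑ r, a r • d (b r) = 0 ∧ t = ∑ r, OmT.tmul (d (a r)) (OmT.tmul (d (b r)) e)}

/-- The left module `Ω² ⊗_ℍ E`, where `Ω² = (Ω¹ ⊗ Ω¹) / ⟨∑ da_r ⊗ db_r : ∑ a_r db_r = 0⟩` are the
two-forms of the maximal exterior algebra over the calculus (`- ⊗_ℍ E` being right exact, the
quotient may be taken after tensoring). -/
def Om2 : Type := OmT (OmT E) ⧸ rel2 E

instance : AddCommGroup (Om2 E) := inferInstanceAs (AddCommGroup (_ ⧸ rel2 E))
instance : Module QH (Om2 E) := inferInstanceAs (Module QH (_ ⧸ rel2 E))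

/-- The map `∧ ⊗ id : Ω¹ ⊗ Ω¹ ⊗ E → Ω² ⊗ E`. -/
def wedge : OmT (OmT E) →ₗ[QH] Om2 E := (rel2 E).mkQ

variable {E F}

theorem wedge_rel {n : ℕ} (a b : Fin n → QH) (e : E) (h : ∑ r, a r • d (b r) = 0) :
    ∑ r, wedge E (OmT.tmul (d (a r)) (OmT.tmul (d (b r)) e)) = 0 := by
  rw [← map_sum]
  exact (Submodule.Quotient.mk_eq_zero _).2 (Submodule.subset_span ⟨n, a, b, e, h, rfl⟩)

/-- The map `id ⊗ f : Ω² ⊗_ℍ E → Ω² ⊗_ℍ F`. -/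
def Om2.map (f : E →ₗ[QH] F) : Om2 E →ₗ[QH] Om2 F :=
  Submodule.mapQ (rel2 E) (rel2 F) (OmT.map (OmT.map f)) (by
    refine Submodule.span_le.2 ?_
    rintro _ ⟨n, a, b, e, h, rfl⟩
    refine Submodule.subset_span ⟨n, a, b, f e, h, ?_⟩
    rw [map_sum]; rfl)

@[simp] theorem Om2.map_wedge (f : E →ₗ[QH] F) (t : OmT (OmT E)) :
    Om2.map f (wedge E t) = wedge F (OmT.map (OmT.map f) t) := rfl

/-- The element `dω ⊗ e` of `Ω² ⊗_ℍ E`, where `d(a di + b dj) = da ∧ di + db ∧ dj`. It satisfies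
`d ∘ d = 0` and both Leibniz rules (`extD_d`, `extD_smul`, `extD_op`). -/
def extD (w : Om) (e : E) : Om2 E :=
  wedge E (OmT.tmul (d w.ci) (OmT.tmul di e) + OmT.tmul (d w.cj) (OmT.tmul dj e))

theorem extD_add_left (v w : Om) (e : E) : extD (v + w) e = extD v e + extD w e := by
  simp only [extD, map_add, OmT.add_tmul]; abel

theorem extD_add_right (w : Om) (e f : E) : extD w (e + f) = extD w e + extD w f := by
  simp only [extD, map_add, OmT.tmul_add]; abel

theorem extD_d (h : QH) (e : E) : extD (d h) e = 0 := by
  have := wedge_rel ![1, -partialI h, -partialJ h] ![h, qi, qj] e (by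
    simp only [Fin.sum_univ_three]
    simp only [Matrix.cons_val_zero, Matrix.cons_val_one, Matrix.cons_val]
    rw [d_qi, d_qj, one_smul]
    nth_rewrite 1 [Om.eq_comb (d h)]
    simp only [ci_d, cj_d, neg_smul]
    abel)
  simp only [Fin.sum_univ_three] at this
  simp only [Matrix.cons_val_zero, Matrix.cons_val_one, Matrix.cons_val, d_one, d_qi, d_qj,
    map_neg, OmT.neg_tmul, OmT.zero_tmul, map_zero, zero_add] at this
  rw [extD, map_add, ci_d, cj_d]
  rw [← neg_eq_zero, neg_add]
  exact this

theorem wedge_gen_i (c : QH) (e : E) : wedge E (OmT.tmul (d (twist c)) (OmT.tmul di e)) =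
    -wedge E (OmT.tmul di (OmT.tmul (d c) e)) := by
  have := wedge_rel ![twist c, -1, qi] ![qi, qi * c, c] e (by
    simp only [Fin.sum_univ_three]
    simp only [Matrix.cons_val_zero, Matrix.cons_val_one, Matrix.cons_val]
    rw [d_mul, d_qi]
    have : MulOpposite.op c • di = twist c • di := by ext1 <;> simp [di]
    rw [this]; simp only [neg_smul, one_smul, smul_add]; abel)
  simp only [Fin.sum_univ_three] at this
  simp only [Matrix.cons_val_zero, Matrix.cons_val_one, Matrix.cons_val, d_one, d_qi, d_qj,
    map_neg, OmT.neg_tmul, OmT.zero_tmul, map_zero, neg_zero, add_zero] at this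
  exact eq_neg_of_add_eq_zero_left this

theorem wedge_gen_j (c : QH) (e : E) : wedge E (OmT.tmul (d (twist c)) (OmT.tmul dj e)) =
    -wedge E (OmT.tmul dj (OmT.tmul (d c) e)) := by
  have := wedge_rel ![twist c, -1, qj] ![qj, qj * c, c] e (by
    simp only [Fin.sum_univ_three]
    simp only [Matrix.cons_val_zero, Matrix.cons_val_one, Matrix.cons_val]
    rw [d_mul, d_qj]
    have : MulOpposite.op c • dj = twist c • dj := by ext1 <;> simp [dj]
    rw [this]; simp only [neg_smul, one_smul, smul_add]; abel)
  simp only [Fin.sum_univ_three] at this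
  simp only [Matrix.cons_val_zero, Matrix.cons_val_one, Matrix.cons_val, d_one, d_qi, d_qj,
    map_neg, OmT.neg_tmul, OmT.zero_tmul, map_zero, neg_zero, add_zero] at this
  exact eq_neg_of_add_eq_zero_left this

theorem smul_di (a c : QH) (e : E) : OmT.tmul (a • di) (c • e) = OmT.tmul ((a * twist c) • di) e := by
  rw [← OmT.op_smul_tmul]; congr 1; ext1 <;> simp [di]

theorem smul_dj (a c : QH) (e : E) : OmT.tmul (a • dj) (c • e) = OmT.tmul ((a * twist c) • dj) e := by
  rw [← OmT.op_smul_tmul]; congr 1; ext1 <;> simp [dj]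

theorem extD_op (w : Om) (c : QH) (e : E) :
    extD (MulOpposite.op c • w) e = extD w (c • e) - wedge E (OmT.tmul w (OmT.tmul (d c) e)) := by
  have hi := smul_di (E := E) 1 c e
  have hj := smul_dj (E := E) 1 c e
  rw [one_smul, one_mul] at hi hj
  have hw : wedge E (OmT.tmul w (OmT.tmul (d c) e)) =
      w.ci • wedge E (OmT.tmul di (OmT.tmul (d c) e)) +
        w.cj • wedge E (OmT.tmul dj (OmT.tmul (d c) e)) := by
    nth_rewrite 1 [Om.eq_comb w]
    simp only [OmT.add_tmul, OmT.smul_tmul, map_add, map_smul]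
  rw [extD, extD, Om.ci_op, Om.cj_op, d_mul, d_mul, hi, hj, hw]
  simp only [OmT.add_tmul, OmT.op_smul_tmul, map_add, OmT.smul_tmul, map_smul, wedge_gen_i,
    wedge_gen_j, smul_neg]
  abel

theorem extD_smul (a : QH) (w : Om) (e : E) :
    extD (a • w) e = wedge E (OmT.tmul (d a) (OmT.tmul w e)) + a • extD w e := by
  rw [extD, extD]
  nth_rewrite 3 [Om.eq_comb w]
  simp only [map_smul, smul_eq_mul, d_mul, OmT.add_tmul, OmT.op_smul_tmul, map_add, OmT.smul_tmul,
    OmT.tmul_add, smul_add, smul_smul]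
  abel

end Jet

section J1

variable (E F : Type) [AddCommGroup E] [Module QH E] [AddCommGroup F] [Module QH F]

/-- The 1-jet module `J¹E = J¹ℍ ⊗_ℍ E`. The splitting of `0 → Ω¹ ⊗ E → J¹E → E → 0` by the
prolongation `e ↦ j¹(e)` identifies it as an additive group with `(Ω¹ ⊗ E) × E`, the pair `(w, e)`
standing for `ι¹(w) + j¹(e)`. The left action is then determined by `j¹(a e) = a j¹(e) + ι¹(da ⊗ e)`.
In terms of `J¹ℍ ⊆ ℍ ⊗ ℍ` modulo the kernel of `x ⊗ y ↦ x dy`, `[x ⊗ y] ⊗ e = x j¹(y e)`. -/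
def J1 : Type := OmT E × E

instance : AddCommGroup (J1 E) := inferInstanceAs (AddCommGroup (OmT E × E))

variable {E F}

def J1.mk (w : OmT E) (e : E) : J1 E := ((w, e) : OmT E × E)

/-- The component in `Ω¹ ⊗ E`. -/
def J1.form : J1 E →+ OmT E := AddMonoidHom.fst (OmT E) E

/-- The component in `E`. -/
def J1.pt : J1 E →+ E := AddMonoidHom.snd (OmT E) E

@[simp] theorem J1.form_mk (w : OmT E) (e : E) : (J1.mk w e).form = w := rfl
@[simp] theorem J1.pt_mk (w : OmT E) (e : E) : (J1.mk w e).pt = e := rfl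
@[ext] theorem J1.ext {x y : J1 E} (h1 : x.form = y.form) (h2 : x.pt = y.pt) : x = y :=
  Prod.ext h1 h2

instance : SMul QH (J1 E) where
  smul a x := J1.mk (a • x.form - OmT.tmul (d a) x.pt) (a • x.pt)

@[simp] theorem J1.form_smul (a : QH) (x : J1 E) :
    (a • x).form = a • x.form - OmT.tmul (d a) x.pt := rfl
@[simp] theorem J1.pt_smul (a : QH) (x : J1 E) : (a • x).pt = a • x.pt := rfl

instance : Module QH (J1 E) where
  one_smul x := by ext1 <;> simp [d_one, OmT.zero_tmul]
  mul_smul a b x := by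
    ext1
    · simp [d_mul, OmT.add_tmul, OmT.op_smul_tmul, OmT.smul_tmul, mul_smul, smul_sub]
      abel
    · simp [mul_smul]
  smul_zero a := by ext1 <;> simp [OmT.tmul_zero]
  smul_add a x y := by
    ext1
    · simp [OmT.tmul_add]; abel
    · simp
  add_smul a b x := by
    ext1
    · simp [OmT.add_tmul, add_smul]; abel
    · simp [add_smul]
  zero_smul x := by ext1 <;> simp [OmT.zero_tmul]

/-- The jet projection `J¹E → E`. -/
def J1.proj : J1 E →ₗ[QH] E where
  toFun := J1.pt
  map_add' := map_add _
  map_smul' _ _ := rfl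

@[simp] theorem J1.proj_apply (x : J1 E) : J1.proj x = x.pt := rfl

/-- The inclusion `ι¹ : Ω¹ ⊗ E → J¹E`. -/
def J1.incl : OmT E →ₗ[QH] J1 E where
  toFun w := J1.mk w 0
  map_add' v w := by ext1 <;> simp
  map_smul' a w := by ext1 <;> simp [OmT.tmul_zero]

@[simp] theorem J1.form_incl (w : OmT E) : (J1.incl w).form = w := rfl
@[simp] theorem J1.pt_incl (w : OmT E) : (J1.incl w).pt = 0 := rfl

/-- The prolongation `j¹ : E → J¹E`. -/
def J1.prolong : E →+ J1 E where
  toFun e := J1.mk 0 e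
  map_zero' := rfl
  map_add' e f := by ext1 <;> simp

@[simp] theorem J1.form_prolong (e : E) : (J1.prolong e).form = 0 := rfl
@[simp] theorem J1.pt_prolong (e : E) : (J1.prolong e).pt = e := rfl

/-- The functor `J¹` on left linear maps; it sends `j¹(e)` to `j¹(f e)` and is `id ⊗ f` on
`Ω¹ ⊗ E`. -/
def J1.map (f : E →ₗ[QH] F) : J1 E →ₗ[QH] J1 F where
  toFun x := J1.mk (OmT.map f x.form) (f x.pt)
  map_add' x y := by ext1 <;> simp
  map_smul' a x := by ext1 <;> simp

@[simp] theorem J1.form_map (f : E →ₗ[QH] F) (x : J1 E) :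
    (J1.map f x).form = OmT.map f x.form := rfl
@[simp] theorem J1.pt_map (f : E →ₗ[QH] F) (x : J1 E) : (J1.map f x).pt = f x.pt := rfl

theorem J1.map_prolong (f : E →ₗ[QH] F) (e : E) : J1.map f (J1.prolong e) = J1.prolong (f e) := by
  ext1 <;> simp

/-- The Spencer operator `J¹E → Ω¹ ⊗ E`, `a j¹(e) ↦ da ⊗ e`; it vanishes exactly on the
prolongations `j¹(e)`. -/
def spencer0 : J1 E →+ OmT E := -J1.form

/-- The Spencer operator `Ω¹ ⊗ J¹E → Ω² ⊗ E`,
`ω ⊗ ξ ↦ dω ⊗ π(ξ) - ω ∧ D(ξ)`, where `D` is the Spencer operator of `J¹E` and `π` the jet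
projection. -/
def spencer1 : OmT (J1 E) →+ Om2 E :=
  OmT.liftAdd
    (AddMonoidHom.mk'
      (fun w => AddMonoidHom.mk'
        (fun x => extD w x.pt - wedge E (OmT.tmul w (spencer0 x)))
        (fun x y => by
          simp only [map_add, extD_add_right, OmT.tmul_add]; abel))
      (fun v w => by
        ext x
        simp only [AddMonoidHom.mk'_apply, AddMonoidHom.add_apply, extD_add_left, OmT.add_tmul,
          map_add]
        abel))
    (fun w c x => by
      simp only [AddMonoidHom.mk'_apply, extD_op, spencer0, AddMonoidHom.neg_apply,
        J1.form_smul, J1.pt_smul, OmT.op_smul_tmul, neg_sub, smul_neg, OmT.tmul_sub, OmT.tmul_neg,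
        map_sub, map_neg]
      abel)

@[simp] theorem spencer1_tmul (w : Om) (x : J1 E) :
    spencer1 (OmT.tmul w x) = extD w x.pt - wedge E (OmT.tmul w (spencer0 x)) := rfl

theorem spencer1_smul (a : QH) (t : OmT (J1 E)) :
    spencer1 (a • t) = wedge E (OmT.tmul (d a) (OmT.map J1.proj t)) + a • spencer1 t := by
  induction t using OmT.induction with
  | zero => simp [OmT.tmul_zero]
  | tmul w x =>
    rw [← OmT.smul_tmul, spencer1_tmul, spencer1_tmul, extD_smul, OmT.map_tmul, OmT.smul_tmul,
      map_smul, smul_sub, J1.proj_apply]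
    abel
  | add s t h1 h2 =>
    simp only [smul_add, map_add, h1, h2, OmT.tmul_add]
    abel

theorem extD_map (f : E →ₗ[QH] F) (w : Om) (e : E) : Om2.map f (extD w e) = extD w (f e) := by
  simp [extD]

theorem spencer1_map (f : E →ₗ[QH] F) (t : OmT (J1 E)) :
    spencer1 (OmT.map (J1.map f) t) = Om2.map f (spencer1 t) := by
  induction t using OmT.induction with
  | zero => simp
  | tmul w x => simp [extD_map, spencer0]
  | add s t h1 h2 => simp only [map_add, h1, h2]

/-- The holonomic 2-jets `J²E ⊆ J¹(J¹E)`: those on which the two projections to `J¹E` agree and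
which the Spencer operators send to zero in `Ω² ⊗ E`. -/
def hol (E : Type) [AddCommGroup E] [Module QH E] : Submodule QH (J1 (J1 E)) where
  carrier := {x | J1.map J1.proj x = J1.proj x ∧ spencer1 (spencer0 x) = 0}
  zero_mem' := by simp
  add_mem' := by
    rintro x y ⟨hx, hx'⟩ ⟨hy, hy'⟩
    exact ⟨by rw [map_add, map_add, hx, hy], by rw [map_add, map_add, hx', hy', add_zero]⟩
  smul_mem' := by
    rintro a x ⟨hx, hx'⟩
    refine ⟨by rw [map_smul, map_smul, hx], ?_⟩
    have h1 : spencer0 (a • x) = OmT.tmul (d a) x.pt + a • spencer0 x := by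
      simp only [spencer0, AddMonoidHom.neg_apply, J1.form_smul, smul_neg]; abel
    have h2 : OmT.map J1.proj x.form = x.pt.form := congrArg J1.form hx
    rw [h1, map_add, spencer1_smul, hx', smul_zero, add_zero, spencer1_tmul, extD_d, spencer0,
      spencer0, AddMonoidHom.neg_apply, AddMonoidHom.neg_apply, map_neg, h2]
    abel

theorem hol_map (f : E →ₗ[QH] F) {x : J1 (J1 E)} (hx : x ∈ hol E) :
    J1.map (J1.map f) x ∈ hol F := by
  obtain ⟨h1, h2⟩ := hx
  refine ⟨?_, ?_⟩
  · have : J1.proj (J1.map (J1.map f) x) = J1.map f (J1.proj x) := rfl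
    rw [this, ← h1]
    ext1
    · simp only [J1.form_map, OmT.map_map]; rfl
    · rfl
  · have : spencer0 (J1.map (J1.map f) x) = OmT.map (J1.map f) (spencer0 x) := by
      simp [spencer0]
    rw [this, spencer1_map, h2, map_zero]

theorem hol_prolong (e : E) : J1.prolong (J1.prolong e) ∈ hol E :=
  ⟨by ext1 <;> simp, by simp [spencer0]⟩

end J1

/-- Two consecutive jet modules `X = JⁿE` and `Y = Jⁿ⁺¹E` together with the canonical map
`l : Jⁿ⁺¹E → J¹(JⁿE)` and the prolongations, used to define the jet modules by recursion. -/
structure JetStage (E : Type) [AddCommGroup E] [Module QH E] where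
  X : Type
  Y : Type
  [gX : AddCommGroup X]
  [mX : Module QH X]
  [gY : AddCommGroup Y]
  [mY : Module QH Y]
  l : Y →ₗ[QH] J1 X
  jX : E →+ X
  jY : E →+ Y
  l_jY : ∀ e, l (jY e) = J1.prolong (jX e)

attribute [instance] JetStage.gX JetStage.mX JetStage.gY JetStage.mY

section Stage

variable {E F : Type} [AddCommGroup E] [Module QH E] [AddCommGroup F] [Module QH F]

/-- `Jⁿ⁺²E` is the preimage of the holonomic 2-jets `J²(JⁿE)` under `J¹(l) : J¹(Jⁿ⁺¹E) → J¹(J¹(JⁿE))`. -/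
def JetStage.next (S : JetStage E) : Submodule QH (J1 S.Y) := (hol S.X).comap (J1.map S.l)

/-- One step of the recursion. -/
def JetStage.step (S : JetStage E) : JetStage E where
  X := S.Y
  Y := S.next
  l := S.next.subtype
  jX := S.jY
  jY := AddMonoidHom.mk' (fun e => ⟨J1.prolong (S.jY e), by
      change J1.map S.l _ ∈ hol S.X
      rw [J1.map_prolong, S.l_jY]; exact hol_prolong _⟩)
    (fun e f => Subtype.ext (by simp))
  l_jY _ := rfl

/-- The sequence of jet modules, starting with `J⁰E = E` and `J¹E`. The next one is `J²E`, the
holonomic 2-jets, then `Jⁿ⁺²E = J¹(Jⁿ⁺¹E) ∩ J²(JⁿE)`. -/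
def stage (E : Type) [AddCommGroup E] [Module QH E] : ℕ → JetStage E
  | 0 => { X := E, Y := J1 E, l := LinearMap.id, jX := AddMonoidHom.id E, jY := J1.prolong
           l_jY := fun _ => rfl }
  | n + 1 => (stage E n).step

/-- The `n`-jet module `JⁿE`. -/
abbrev Jet (E : Type) [AddCommGroup E] [Module QH E] (n : ℕ) : Type := (stage E n).X

/-- The `n`-jet prolongation `jⁿ : E → JⁿE`. -/
def jet (n : ℕ) : E →+ Jet E n := (stage E n).jX

/-- The jet projection `Jⁿ⁺¹E → JⁿE`. -/
def jetProj (n : ℕ) : Jet E (n + 1) →ₗ[QH] Jet E n := J1.proj ∘ₗ (stage E n).l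

theorem jetProj_jet (n : ℕ) (e : E) : jetProj n (jet (n + 1) e) = jet n e := by
  change J1.proj ((stage E n).l ((stage E n).jY e)) = _
  rw [(stage E n).l_jY]; rfl

/-- A map that prolongs the additive map `Δ` to the two jet modules of a stage; an auxiliary
notion for the proof that differential operators compose. -/
def StageHom (Δ : E →+ F) (S : JetStage E) (T : JetStage F) : Prop :=
  ∃ (f : S.X →ₗ[QH] T.X) (g : S.Y →ₗ[QH] T.Y), (∀ y, T.l (g y) = J1.map f (S.l y)) ∧
    (∀ e, f (S.jX e) = T.jX (Δ e)) ∧ ∀ e, g (S.jY e) = T.jY (Δ e)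

theorem StageHom.step {Δ : E →+ F} {S : JetStage E} {T : JetStage F} (h : StageHom Δ S T) :
    StageHom Δ S.step T.step := by
  obtain ⟨f, g, h1, h2, h3⟩ := h
  have hmem : ∀ y : S.next, J1.map g y.1 ∈ T.next := by
    intro y
    change J1.map T.l (J1.map g y.1) ∈ hol T.X
    have : J1.map T.l (J1.map g y.1) = J1.map (J1.map f) (J1.map S.l y.1) := by
      ext1
      · simp only [J1.form_map, OmT.map_map]
        congr 2; ext1 z; exact h1 z
      · exact h1 _
    rw [this]; exact hol_map f y.2
  refine ⟨g, LinearMap.codRestrict T.next (J1.map g ∘ₗ S.next.subtype) hmem, fun y => rfl, h3, ?_⟩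
  intro e
  apply Subtype.ext
  change J1.map g (J1.prolong (S.jY e)) = J1.prolong (T.jY (Δ e))
  rw [J1.map_prolong, h3]

theorem stageHom_stage {Δ : E →+ F} {m : ℕ} (φ : Jet E m →ₗ[QH] F) (h : ∀ e, φ (jet m e) = Δ e)
    (n : ℕ) : StageHom Δ (stage E (m + n)) (stage F n) := by
  induction n with
  | zero =>
    refine ⟨φ, J1.map φ ∘ₗ (stage E m).l, fun y => rfl, h, fun e => ?_⟩
    change J1.map φ ((stage E m).l ((stage E m).jY e)) = J1.prolong (Δ e)
    rw [(stage E m).l_jY, J1.map_prolong]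
    congr 1; exact h e
  | succ n ih => exact ih.step

end Stage

section DiffOps

instance : AddCommGroup (QH →ₗ[ℝ] QH) :=
  { LinearMap.addCommMonoid (M := QH) (M₂ := QH) (σ₁₂ := RingHom.id ℝ),
    (LinearMap.addCommGroup : AddCommGroup (QH →ₗ[ℝ] QH)) with }

/-- The linear differential operators `Diffⁿ(ℍ, ℍ)` of order at most `n`: the `ℝ`-linear maps
`Δ : ℍ → ℍ` that factor as `Δ = φ ∘ jⁿ` with `φ : Jⁿℍ → ℍ` left `ℍ`-linear. -/
def DiffOp (n : ℕ) : Submodule ℝ (QH →ₗ[ℝ] QH) where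
  carrier := {Δ | ∃ φ : Jet QH n →ₗ[QH] QH, ∀ h, φ (jet n h) = Δ h}
  zero_mem' := ⟨0, fun _ => rfl⟩
  add_mem' := by
    rintro _ _ ⟨φ, hφ⟩ ⟨ψ, hψ⟩
    exact ⟨φ + ψ, fun h => by simp [hφ, hψ]⟩
  smul_mem' := by
    rintro c _ ⟨φ, hφ⟩
    exact ⟨c • φ, fun h => by simp [hφ]⟩

theorem DiffOp.le_succ (n : ℕ) : DiffOp n ≤ DiffOp (n + 1) := by
  rintro _ ⟨φ, hφ⟩
  exact ⟨φ ∘ₗ jetProj n, fun h => by rw [LinearMap.comp_apply, jetProj_jet, hφ]⟩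

theorem DiffOp.mono : Monotone DiffOp := monotone_nat_of_le_succ DiffOp.le_succ

theorem DiffOp.comp_mem {n m : ℕ} {Δ₁ Δ₂ : QH →ₗ[ℝ] QH} (h₁ : Δ₁ ∈ DiffOp n)
    (h₂ : Δ₂ ∈ DiffOp m) : Δ₁ ∘ₗ Δ₂ ∈ DiffOp (n + m) := by
  obtain ⟨φ, hφ⟩ := h₁
  obtain ⟨ψ, hψ⟩ := h₂
  obtain ⟨f, -, -, hf, -⟩ := stageHom_stage (Δ := Δ₂.toAddMonoidHom) ψ hψ n
  rw [add_comm]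
  exact ⟨φ ∘ₗ f, fun h => (congrArg φ (hf h)).trans (hφ _)⟩

/-- Composition of differential operators. -/
def comp (n m : ℕ) : DiffOp n →ₗ[ℝ] DiffOp m →ₗ[ℝ] DiffOp (n + m) :=
  LinearMap.mk₂ ℝ (fun Δ₁ Δ₂ => ⟨Δ₁.1 ∘ₗ Δ₂.1, DiffOp.comp_mem Δ₁.2 Δ₂.2⟩)
    (fun _ _ _ => rfl) (fun _ _ _ => rfl)
    (fun _ _ _ => Subtype.ext (by simp [LinearMap.comp_add]))
    (fun _ _ _ => Subtype.ext (by simp [LinearMap.comp_smul]))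

/-- Composition of a differential operator with a left `ℍ`-linear map. -/
def postComp (ψ : QH →ₗ[QH] QH) (n : ℕ) : DiffOp n →ₗ[ℝ] DiffOp n where
  toFun Δ := ⟨ψ.restrictScalars ℝ ∘ₗ Δ.1, by
    obtain ⟨φ, hφ⟩ := Δ.2
    exact ⟨ψ ∘ₗ φ, fun h => congrArg ψ (hφ h)⟩⟩
  map_add' _ _ := Subtype.ext (by simp [LinearMap.comp_add])
  map_smul' _ _ := Subtype.ext (by simp [LinearMap.comp_smul])

/-- `Diffⁿ⁻¹`, with `Diff⁻¹ = 0`. -/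
def lowerOrder : ℕ → Submodule ℝ (QH →ₗ[ℝ] QH)
  | 0 => ⊥
  | n + 1 => DiffOp n

theorem lowerOrder_comp_left {n m : ℕ} {Δ₁ Δ₂ : QH →ₗ[ℝ] QH} (h₁ : Δ₁ ∈ lowerOrder n)
    (h₂ : Δ₂ ∈ DiffOp m) : Δ₁ ∘ₗ Δ₂ ∈ lowerOrder (n + m) := by
  cases n with
  | zero => rw [(Submodule.mem_bot ℝ).1 h₁, LinearMap.zero_comp]; exact zero_mem _
  | succ n => rw [Nat.succ_add]; exact DiffOp.comp_mem h₁ h₂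

theorem lowerOrder_comp_right {n m : ℕ} {Δ₁ Δ₂ : QH →ₗ[ℝ] QH} (h₁ : Δ₁ ∈ DiffOp n)
    (h₂ : Δ₂ ∈ lowerOrder m) : Δ₁ ∘ₗ Δ₂ ∈ lowerOrder (n + m) := by
  cases m with
  | zero => rw [(Submodule.mem_bot ℝ).1 h₂, LinearMap.comp_zero]; exact zero_mem _
  | succ m => exact DiffOp.comp_mem h₁ h₂

/-- `Diffⁿ⁻¹` as a subspace of `Diffⁿ`. -/
abbrev symbKer (n : ℕ) : Submodule ℝ (DiffOp n) := (lowerOrder n).comap (DiffOp n).subtype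

/-- The symbols `Symbⁿ(ℍ, ℍ) = Diffⁿ / Diffⁿ⁻¹` of order `n`. -/
def Symb (n : ℕ) : Type := DiffOp n ⧸ symbKer n

instance (n : ℕ) : AddCommGroup (Symb n) := inferInstanceAs (AddCommGroup (DiffOp n ⧸ symbKer n))
instance (n : ℕ) : Module ℝ (Symb n) := inferInstanceAs (Module ℝ (DiffOp n ⧸ symbKer n))

/-- The symbol map `ςⁿ : Diffⁿ → Symbⁿ`. -/
def symb (n : ℕ) : DiffOp n →ₗ[ℝ] Symb n := (symbKer n).mkQ

/-- The graded space of symbols `⨁ₙ Symbⁿ(ℍ, ℍ)`. -/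
abbrev SymbAlg : Type := DirectSum ℕ Symb

/-- The inclusion of `Symbⁿ` into the graded space. -/
def inDeg (n : ℕ) : Symb n →ₗ[ℝ] SymbAlg := DirectSum.lof ℝ ℕ Symb n

/-- The bilinear extension to the graded space of a family of bilinear maps on homogeneous
components. -/
def bilinExt (f : ∀ n m, Symb n →ₗ[ℝ] Symb m →ₗ[ℝ] SymbAlg) :
    SymbAlg →ₗ[ℝ] SymbAlg →ₗ[ℝ] SymbAlg :=
  DirectSum.toModule ℝ ℕ _ fun n =>
    (DirectSum.toModule ℝ ℕ _ fun m => (f n m).flip).flip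

theorem bilinExt_inDeg (f : ∀ n m, Symb n →ₗ[ℝ] Symb m →ₗ[ℝ] SymbAlg) (n m : ℕ)
    (σ : Symb n) (τ : Symb m) : bilinExt f (inDeg n σ) (inDeg m τ) = f n m σ τ := by
  simp [bilinExt, inDeg, DirectSum.toModule_lof]

/-- The product of homogeneous symbols, induced by composition of operators:
`ςⁿ(Δ₁) · ςᵐ(Δ₂) = ςⁿ⁺ᵐ(Δ₁ ∘ Δ₂)`. -/
def symbMulHom (n m : ℕ) : Symb n →ₗ[ℝ] Symb m →ₗ[ℝ] Symb (n + m) :=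
  Submodule.liftQ (symbKer n)
    (LinearMap.flip (Submodule.liftQ (symbKer m) ((comp n m).compr₂ (symb (n + m))).flip (by
      intro Δ₂ h₂
      refine LinearMap.ext fun Δ₁ => (Submodule.Quotient.mk_eq_zero _).2 ?_
      exact lowerOrder_comp_right Δ₁.2 h₂)))
    (by
      intro Δ₁ h₁
      refine LinearMap.ext fun τ => ?_
      obtain ⟨Δ₂, rfl⟩ := Submodule.mkQ_surjective _ τ
      exact (Submodule.Quotient.mk_eq_zero _).2 (lowerOrder_comp_left h₁ Δ₂.2))

theorem symbMulHom_symb (n m : ℕ) (Δ₁ : DiffOp n) (Δ₂ : DiffOp m) :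
    symbMulHom n m (symb n Δ₁) (symb m Δ₂) = symb (n + m) (comp n m Δ₁ Δ₂) := rfl

/-- The product `·` of the symbol algebra. -/
def symbMul : SymbAlg →ₗ[ℝ] SymbAlg →ₗ[ℝ] SymbAlg :=
  bilinExt fun n m => (symbMulHom n m).compr₂ (inDeg (n + m))

/-- A full quantization for `(ℍ, ℍ)`: for each `n` a linear section `qⁿ : Symbⁿ → Diffⁿ` of the
symbol map that is linear over the left `ℍ`-linear endomorphisms of the target. -/
structure FullQuantization where
  q : ∀ n, Symb n →ₗ[ℝ] DiffOp n
  symb_q : ∀ n σ, symb n (q n σ) = σ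
  q_postComp : ∀ (ψ : QH →ₗ[QH] QH) (n : ℕ) (Δ : DiffOp n),
    q n (symb n (postComp ψ n Δ)) = postComp ψ n (q n (symb n Δ))

namespace FullQuantization

variable (Q : FullQuantization)

/-- The operator `Δ - qⁿ⁺¹(ςⁿ⁺¹(Δ))`, for `Δ` of order at most `n + 1`; it has order at most `n`. -/
def truncStep (n : ℕ) : DiffOp (n + 1) →ₗ[ℝ] DiffOp n where
  toFun Δ := ⟨Δ.1 - (Q.q (n + 1) (symb (n + 1) Δ)).1, by
    have h : symb (n + 1) (Δ - Q.q (n + 1) (symb (n + 1) Δ)) = 0 := by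
      rw [map_sub, Q.symb_q, sub_self]
    exact (Submodule.Quotient.mk_eq_zero (symbKer (n + 1))).1 h⟩
  map_add' _ _ := Subtype.ext (by simp; abel)
  map_smul' _ _ := Subtype.ext (by simp [smul_sub])

/-- The truncation to order `k` of an operator of order at most `k + r`: the components of order
`k + r, …, k + 1` are removed in turn. -/
def truncAux (k : ℕ) : (r : ℕ) → DiffOp (k + r) →ₗ[ℝ] DiffOp k
  | 0 => LinearMap.id
  | r + 1 => truncAux k r ∘ₗ Q.truncStep (k + r)

/-- The truncation to order `k` of an operator of order at most `N`. -/
def trunc (N k : ℕ) : DiffOp N →ₗ[ℝ] DiffOp k :=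
  Q.truncAux k N ∘ₗ Submodule.inclusion (DiffOp.mono (Nat.le_add_left N k))

/-- The symbol of order `k` in the decomposition `Δ = ∑ₖ qᵏ(σₖ)` of an operator of order at
most `N`, i.e. the `k`-th symbol of the truncation of `Δ` to order `k`. -/
def symbComp (N k : ℕ) : DiffOp N →ₗ[ℝ] Symb k := symb k ∘ₗ Q.trunc N k

/-- The star product of homogeneous symbols: if `qⁿ(σ) ∘ qᵐ(τ) = ∑ₗ qˡ(σₗ)`, then
`σ ⋆ τ = ∑ₖ ħᵏ σ_{n+m-k}`. -/
def starHom (ħ : ℝ) (n m : ℕ) : Symb n →ₗ[ℝ] Symb m →ₗ[ℝ] SymbAlg :=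
  ((comp n m).compl₁₂ (Q.q n) (Q.q m)).compr₂
    (∑ k ∈ Finset.range (n + m + 1), ħ ^ k • inDeg (n + m - k) ∘ₗ Q.symbComp (n + m) (n + m - k))

theorem starHom_apply (ħ : ℝ) (n m : ℕ) (σ : Symb n) (τ : Symb m) :
    Q.starHom ħ n m σ τ = ∑ k ∈ Finset.range (n + m + 1),
      ħ ^ k • inDeg (n + m - k) (Q.symbComp (n + m) (n + m - k) (comp n m (Q.q n σ) (Q.q m τ))) := by
  simp [starHom]

/-- The star product `⋆` with parameter `ħ` on the space of symbols. -/
def star (ħ : ℝ) : SymbAlg →ₗ[ℝ] SymbAlg →ₗ[ℝ] SymbAlg := bilinExt (Q.starHom ħ)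

end FullQuantization

/-- The right multiplication operator `R_c(h) = h c`, of order zero. -/
def rightMulOp (c : QH) : DiffOp 0 :=
  ⟨(LinearMap.toSpanSingleton QH QH c).restrictScalars ℝ,
    LinearMap.toSpanSingleton QH QH c, fun _ => rfl⟩

theorem rightMulOp_apply (c h : QH) : (rightMulOp c).1 h = h * c := rfl

theorem partial_mem (c : Om →ₗ[QH] QH) (Δ : QH →ₗ[ℝ] QH) (hc : ∀ h, c (d h) = Δ h)
    (hop : ∀ (w : Om) (h : QH), c (MulOpposite.op h • w) = c w * twist h) : Δ ∈ DiffOp 1 := by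
  let f : OmT QH →ₗ[QH] QH := OmT.lift
    (AddMonoidHom.mk' (fun w => AddMonoidHom.mk' (fun e => c w * twist e)
      (fun x y => by rw [map_add, mul_add])) (fun v w => by ext1 x; simp [add_mul]))
    (fun w a e => by simp [hop, mul_assoc]) (fun a w e => by simp [mul_assoc])
  let φ : J1 QH →ₗ[QH] QH :=
    { toFun := fun x => f x.form + Δ x.pt
      map_add' := fun x y => by simp only [map_add]; abel
      map_smul' := fun a x => by
        have h1 : Δ (a * x.pt) = a * Δ x.pt + Δ a * twist x.pt := by
          rw [← hc, d_mul, map_add, hop, map_smul, hc, hc, add_comm, smul_eq_mul]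
        have h2 : f (OmT.tmul (d a) x.pt) = Δ a * twist x.pt := by
          change c (d a) * twist x.pt = _
          rw [hc]
        simp only [J1.form_smul, J1.pt_smul, map_sub, map_smul, smul_eq_mul, h1, h2,
          RingHom.id_apply, mul_add]
        abel }
  exact ⟨φ, fun h => by
    change f (J1.prolong h).form + Δ h = Δ h
    simp⟩

/-- The operators `∂_i` (index `0`) and `∂_j` (index `1`), of order at most one. -/
def partialD : Fin 2 → DiffOp 1
  | 0 => ⟨partialI, partial_mem Om.ci partialI (fun _ => rfl) (fun _ _ => rfl)⟩
  | 1 => ⟨partialJ, partial_mem Om.cj partialJ (fun _ => rfl) (fun _ _ => rfl)⟩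

end DiffOps

section Connection

/-- The right action of `c` on forms, as a left linear map; thus `OmT.map (Om.rmul c)` is the right
action of `c` on `Ω¹ ⊗ Ω¹`. -/
def Om.rmul (c : QH) : Om →ₗ[QH] Om where
  toFun w := MulOpposite.op c • w
  map_add' := smul_add _
  map_smul' a w := smul_comm _ a w

@[simp] theorem Om.rmul_apply (c : QH) (w : Om) : Om.rmul c w = MulOpposite.op c • w := rfl

/-- A bimodule connection on `Ω¹`: a left connection `∇ : Ω¹ → Ω¹ ⊗ Ω¹` together with a bimodule map
`σ : Ω¹ ⊗ Ω¹ → Ω¹ ⊗ Ω¹`, its generalized braiding, with `∇(w c) = ∇(w) c + σ(w ⊗ dc)`. -/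
structure BimoduleConnection where
  nabla : Om →+ OmT Om
  sigma : OmT Om →ₗ[QH] OmT Om
  nabla_smul : ∀ (a : QH) (w : Om), nabla (a • w) = OmT.tmul (d a) w + a • nabla w
  sigma_right : ∀ (c : QH) (t : OmT Om),
    sigma (OmT.map (Om.rmul c) t) = OmT.map (Om.rmul c) (sigma t)
  nabla_op : ∀ (c : QH) (w : Om),
    nabla (MulOpposite.op c • w) = OmT.map (Om.rmul c) (nabla w) + sigma (OmT.tmul w (d c))

/-- The map `a di + b dj ↦ (k a k⁻¹) di + (k b k⁻¹) dj`. -/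
def Om.tw : Om →+ Om where
  toFun w := Om.mk (twist w.ci) (twist w.cj)
  map_zero' := by ext1 <;> simp
  map_add' v w := by ext1 <;> simp

theorem twist_twist (h : QH) : twist (twist h) = h := by
  apply Quaternion.ext <;> simp [twist_apply]

theorem Om.tw_smul (a : QH) (w : Om) : Om.tw (a • w) = twist a • Om.tw w := by
  ext1 <;> simp [Om.tw]

theorem Om.tw_op (c : QH) (w : Om) : Om.tw (MulOpposite.op c • w) = MulOpposite.op (twist c) • Om.tw w := by
  ext1 <;> simp [Om.tw]

/-- The braiding, the bimodule map with `ω ⊗ ν ↦ -ν ⊗ ω` for `ω, ν ∈ {di, dj}`. -/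
def braiding : OmT Om →ₗ[QH] OmT Om :=
  OmT.lift
    (AddMonoidHom.mk' (fun w => AddMonoidHom.mk'
        (fun v => -(w.ci • OmT.tmul (Om.tw v) di + w.cj • OmT.tmul (Om.tw v) dj))
        (fun x y => by simp only [map_add, OmT.add_tmul, smul_add]; abel))
      (fun v w => by
        ext1 x
        simp only [AddMonoidHom.mk'_apply, AddMonoidHom.add_apply, map_add, add_smul]; abel))
    (fun w c v => by
      simp only [AddMonoidHom.mk'_apply, Om.ci_op, Om.cj_op, Om.tw_smul, OmT.smul_tmul, mul_smul])
    (fun a w v => by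
      simp only [AddMonoidHom.mk'_apply, map_smul, smul_eq_mul, mul_smul, smul_neg, smul_add])

theorem braiding_tmul (w v : Om) : braiding (OmT.tmul w v) =
    -(w.ci • OmT.tmul (Om.tw v) di + w.cj • OmT.tmul (Om.tw v) dj) := rfl

theorem op_di (c : QH) : MulOpposite.op c • di = twist c • di := by ext1 <;> simp [di]
theorem op_dj (c : QH) : MulOpposite.op c • dj = twist c • dj := by ext1 <;> simp [dj]
theorem tw_di : Om.tw di = di := by ext1 <;> simp [di, Om.tw]
theorem tw_dj : Om.tw dj = dj := by ext1 <;> simp [dj, Om.tw]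

theorem d_twist (c : QH) : Om.tw (d c) = -d (twist c) := by
  ext1 <;> apply Quaternion.ext <;> simp [Om.tw, partialI_apply, partialJ_apply, twist_apply]

/-- The flat Levi-Civita bimodule connection of the calculus: the Grassmann connection of the frame
`di, dj`, that is `∇di = ∇dj = 0` and `∇(a di + b dj) = da ⊗ di + db ⊗ dj`, with its braiding. -/
def levi : BimoduleConnection where
  nabla := AddMonoidHom.mk' (fun w => OmT.tmul (d w.ci) di + OmT.tmul (d w.cj) dj)
    (fun v w => by simp only [map_add, OmT.add_tmul]; abel)
  sigma := braiding
  nabla_smul a w := by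
    have hw : OmT.tmul (d a) w = OmT.tmul (d a) (w.ci • di) + OmT.tmul (d a) (w.cj • dj) := by
      rw [← OmT.tmul_add, ← Om.eq_comb]
    simp only [AddMonoidHom.mk'_apply, hw, map_smul, smul_eq_mul, d_mul, OmT.add_tmul,
      OmT.op_smul_tmul, OmT.smul_tmul, smul_add]
    abel
  sigma_right c t := by
    induction t using OmT.induction with
    | zero => simp
    | tmul w v =>
      simp only [OmT.map_tmul, Om.rmul_apply, braiding_tmul, Om.tw_op, map_neg, map_add, map_smul,
        op_di, op_dj, OmT.op_smul_tmul]
    | add s t h1 h2 => simp only [map_add, h1, h2]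
  nabla_op c w := by
    simp only [AddMonoidHom.mk'_apply, Om.ci_op, Om.cj_op, map_add, OmT.map_tmul, Om.rmul_apply,
      braiding_tmul, d_twist, d_mul, op_di, op_dj, OmT.add_tmul, OmT.op_smul_tmul, OmT.smul_tmul,
      OmT.neg_tmul, smul_neg]
    abel

end Connection

section Induced

/-- The identification `Ω¹ = Ω¹ ⊗_ℍ ℍ`. -/
def insOne : Om →ₗ[QH] OmT QH where
  toFun w := OmT.tmul w 1
  map_add' v w := OmT.add_tmul v w 1
  map_smul' a w := OmT.smul_tmul a w 1

/-- The wedge product `Ω¹ ⊗ Ω¹ → Ω²`. -/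
def wedgeOm : OmT Om →ₗ[QH] Om2 QH := wedge QH ∘ₗ OmT.map insOne

/-- The quantum symmetric two-tensors, the kernel of `∧ : Ω¹ ⊗ Ω¹ → Ω²`. -/
def S2 : Submodule QH (OmT Om) := LinearMap.ker wedgeOm

/-- The quantum metric `g = di ⊗ dj - dj ⊗ di`. -/
def metric : OmT Om := OmT.tmul di dj - OmT.tmul dj di

theorem metric_mem : metric ∈ S2 := by
  have := wedge_rel ![1, qj, -qi] ![qk, qi, qj] (1 : QH) (by
    simp only [Fin.sum_univ_three]
    simp only [Matrix.cons_val_zero, Matrix.cons_val_one, Matrix.cons_val]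
    rw [d_qi, d_qj, d_qk, one_smul, neg_smul]; abel)
  simp only [Fin.sum_univ_three] at this
  simp only [Matrix.cons_val_zero, Matrix.cons_val_one, Matrix.cons_val, d_one, d_qi, d_qj,
    map_neg, OmT.neg_tmul, OmT.zero_tmul, map_zero, zero_add] at this
  change wedge QH (OmT.map insOne (OmT.tmul di dj - OmT.tmul dj di)) = 0
  rw [map_sub, map_sub, ← neg_eq_zero, ← this]
  change -(wedge QH (OmT.tmul di (OmT.tmul dj 1)) - wedge QH (OmT.tmul dj (OmT.tmul di 1))) = _
  abel

theorem add_braiding_tmul (w v : Om) : OmT.tmul w v + braiding (OmT.tmul w v) =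
    (w.ci * twist v.cj - w.cj * twist v.ci) • metric := by
  have hw := Om.eq_comb w
  have e1 : ∀ (u : Om) (c : QH), OmT.tmul di (c • u) = twist c • OmT.tmul di u := fun u c => by
    rw [← OmT.op_smul_tmul, op_di, OmT.smul_tmul]
  have e2 : ∀ (u : Om) (c : QH), OmT.tmul dj (c • u) = twist c • OmT.tmul dj u := fun u c => by
    rw [← OmT.op_smul_tmul, op_dj, OmT.smul_tmul]
  have h1 : OmT.tmul w v = w.ci • OmT.tmul di v + w.cj • OmT.tmul dj v := by
    nth_rewrite 1 [hw]; rw [OmT.add_tmul, OmT.smul_tmul, OmT.smul_tmul]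
  have h2 : Om.tw v = twist v.ci • di + twist v.cj • dj := by
    ext1 <;> simp [Om.tw, di, dj]
  have h3 : ∀ u : Om, OmT.tmul u v = OmT.tmul u (v.ci • di) + OmT.tmul u (v.cj • dj) := fun u => by
    rw [← OmT.tmul_add, ← Om.eq_comb]
  rw [braiding_tmul, h1, h2, h3, h3]
  simp only [e1, e2, OmT.add_tmul, OmT.smul_tmul, metric, smul_sub, sub_smul, smul_add, mul_smul]
  abel

/-- The map `½ (id + σ)` on `Ω¹ ⊗ Ω¹`. -/
def symmetrize (C : BimoduleConnection) (t : OmT Om) : OmT Om := (2 : QH)⁻¹ • (t + C.sigma t)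

theorem symmetrize_mem (t : OmT Om) : symmetrize levi t ∈ S2 := by
  refine S2.smul_mem _ ?_
  change t + braiding t ∈ S2
  induction t using OmT.induction with
  | zero => simp
  | tmul w v => rw [add_braiding_tmul]; exact S2.smul_mem _ metric_mem
  | add s t h1 h2 =>
    have : s + t + braiding (s + t) = (s + braiding s) + (t + braiding t) := by
      rw [map_add]; abel
    rw [this]; exact S2.add_mem h1 h2

/-- The map `s^{1,1} = ½ (id + σ) : Ω¹ ⊗ Ω¹ → S²`. -/
def s11 (t : OmT Om) : S2 := ⟨symmetrize levi t, symmetrize_mem t⟩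

/-- The inclusion `ι¹ : Ω¹ → J¹ℍ`. -/
def iota1 : Om →ₗ[QH] J1 QH := (J1.incl : OmT QH →ₗ[QH] J1 QH) ∘ₗ insOne

theorem spencer1_incl (t : OmT Om) :
    spencer1 (OmT.map ((J1.incl : OmT QH →ₗ[QH] J1 QH) ∘ₗ insOne) t) = wedgeOm t := by
  induction t using OmT.induction with
  | zero => simp
  | tmul w v =>
    simp only [OmT.map_tmul, spencer1_tmul, LinearMap.comp_apply, J1.pt_incl, spencer0,
      AddMonoidHom.neg_apply, J1.form_incl, OmT.tmul_neg, map_neg, sub_neg_eq_add]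
    have : extD w (0 : QH) = 0 := by simp [extD, OmT.tmul_zero]
    rw [this, zero_add]; rfl
  | add s t h1 h2 => simp only [map_add, h1, h2]

theorem J1.map_id (x : J1 (J1 QH)) : J1.map LinearMap.id x = x := by
  ext1
  · rw [J1.form_map]
    induction x.form using OmT.induction with
    | zero => simp
    | tmul w e => rfl
    | add s t h1 h2 => rw [map_add, h1, h2]
  · rfl

theorem map_proj_iota1 (t : OmT Om) :
    OmT.map (J1.proj : J1 QH →ₗ[QH] QH) (OmT.map iota1 t) = 0 := by
  induction t using OmT.induction with
  | zero => simp
  | tmul w e => exact OmT.tmul_zero w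
  | add s t h1 h2 => rw [map_add, map_add, h1, h2, add_zero]

theorem incl_mem_hol (t : OmT Om) (ht : t ∈ S2) :
    (J1.incl (OmT.map iota1 t) : J1 (J1 QH)) ∈ hol QH := by
  refine ⟨?_, ?_⟩
  · ext1
    · rw [J1.form_map, J1.form_incl, map_proj_iota1]; rfl
    · rfl
  · have h : spencer0 (J1.incl (OmT.map iota1 t)) = -OmT.map iota1 t := rfl
    rw [h, map_neg, neg_eq_zero]
    exact (spencer1_incl t).trans ht

/-- The inclusion `ι² : S² → J²ℍ`, the restriction of
`Ω¹ ⊗ Ω¹ → Ω¹ ⊗ J¹ℍ → J¹(J¹ℍ)`. -/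
def iota2 : S2 →ₗ[QH] Jet QH 2 :=
  LinearMap.codRestrict (stage QH 0).next
    ((J1.incl : OmT (J1 QH) →ₗ[QH] J1 (J1 QH)) ∘ₗ OmT.map iota1 ∘ₗ S2.subtype)
    (fun t => (congrArg (· ∈ hol QH) (J1.map_id _)).mpr (incl_mem_hol t.1 t.2))

/-- `φ` is a left linear lift of `Δ` to the jet module, `Δ = φ ∘ jⁿ`. -/
def IsLift (n : ℕ) (Δ : DiffOp n) (φ : Jet QH n →ₗ[QH] QH) : Prop := ∀ h, φ (jet n h) = Δ.1 h

/-- The full quantization induced by the connection `∇` and `s^{1,1}`: `q⁰ = id`,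
`q¹(σ) = r¹(σ) ∘ d`, `q²(σ) = r²(σ) ∘ s^{1,1} ∘ ∇ ∘ d`, and the other components are zero. Here
`rⁿ(σ) : Sⁿ → ℍ` is the left linear map given by the symbol, namely `φ ∘ ιⁿ` for `σ` the symbol of an
operator with lift `φ`. -/
structure IsInduced (Q : FullQuantization) : Prop where
  q_zero : ∀ Δ : DiffOp 0, Q.q 0 (symb 0 Δ) = Δ
  q_one : ∀ (Δ : DiffOp 1) (φ : Jet QH 1 →ₗ[QH] QH), IsLift 1 Δ φ →
    ∀ h, (Q.q 1 (symb 1 Δ)).1 h = φ (iota1 (d h))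
  q_two : ∀ (Δ : DiffOp 2) (φ : Jet QH 2 →ₗ[QH] QH), IsLift 2 Δ φ →
    ∀ h, (Q.q 2 (symb 2 Δ)).1 h = φ (iota2 (s11 (levi.nabla (d h))))
  q_ge_three : ∀ n, 3 ≤ n → Q.q n = 0

end Induced

/-- The units `i` (index `0`) and `j` (index `1`). -/
def unitQ : Fin 2 → QH
  | 0 => qi
  | 1 => qj

/-- The generalized positions `x_a = ς⁰(R_a)`, for `a ∈ {i, j}`. -/
def symbX (a : Fin 2) : SymbAlg := inDeg 0 (symb 0 (rightMulOp (unitQ a)))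

/-- The generalized momenta `p_a = ς¹(∂_a)`, for `a ∈ {i, j}`. -/
def symbP (a : Fin 2) : SymbAlg := inDeg 1 (symb 1 (partialD a))

/-- The unit `1 = ς⁰(id)` of the symbol algebra. -/
def symbOne : SymbAlg := inDeg 0 (symb 0 (rightMulOp 1))

/-- The subalgebra generated by `S` for the product `μ`: the smallest subspace that contains the
unit and `S` and is closed under `μ`. -/
def genSubalg (μ : SymbAlg →ₗ[ℝ] SymbAlg →ₗ[ℝ] SymbAlg) (S : Set SymbAlg) : Submodule ℝ SymbAlg :=
  sInf {N | symbOne ∈ N ∧ S ⊆ N ∧ ∀ a ∈ N, ∀ b ∈ N, μ a b ∈ N}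

end QuatQuant

end

open QuatQuant

/-!
Every real linear endomorphism of `ℍ` has a unique expansion `R_a + R_b ∂_i + R_c ∂_j + R_e ∂_i ∂_j`
in partial derivatives. The endomorphism has order one exactly if `e = 0`: the jets of `1, i, j, k`
satisfy a relation of first order that comes from `dk = -j di + i dj`, and on it every left linear
lift takes the value `e`. That relation, in the second jets, is also `ι²` of the metric, and
`s^{1,1} ∇ d h` is `h_k` times the metric. Hence the quantization induced by `∇` and `s^{1,1}` can
only be the one that keeps the top terms of the expansion.

In a star product `σ ⋆ τ` of symbols of orders `n` and `m` the powers of `ħ` measure how far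
`qⁿ(σ) ∘ qᵐ(τ)` is from being the quantization of a symbol of order `n + m`. Compositions of
partial derivatives, possibly followed by a right multiplication, are quantizations of their
symbols, so the only correction is the zeroth order term in
`∂_a (h c) = ∂_a(h) k c k⁻¹ + h ∂_a(c)`.
-/

noncomputable section

namespace QuatQuant

section Quaternions

theorem qi_mul_qj : qi * qj = qk := by apply Quaternion.ext <;> simp [qi, qj, qk]

theorem qj_mul_qi : qj * qi = -qk := by apply Quaternion.ext <;> simp [qi, qj, qk]

theorem eq_sum_units (h : QH) : h = h.re • (1 : QH) + h.imI • qi + h.imJ • qj + h.imK • qk := by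
  apply Quaternion.ext <;> simp [qi, qj, qk]

theorem map_eq_sum_units {V : Type*} [AddCommMonoid V] [Module ℝ V] (A : QH →ₗ[ℝ] V) (h : QH) :
    A h = h.re • A 1 + h.imI • A qi + h.imJ • A qj + h.imK • A qk := by
  conv_lhs => rw [eq_sum_units h]
  simp only [map_add, map_smul]

theorem partialI_partialJ (h : QH) : partialI (partialJ h) = (h.imK : QH) := by
  apply Quaternion.ext <;> simp [partialI_apply, partialJ_apply]

end Quaternions

section Operators

/-- Composition with the right multiplication by `c`, as a left `ℍ`-linear map acting on
differential operators. -/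
def rightCoeff (c : QH) (n : ℕ) : DiffOp n →ₗ[ℝ] DiffOp n :=
  postComp (LinearMap.toSpanSingleton QH QH c) n

theorem rightCoeff_apply (c : QH) (n : ℕ) (A : DiffOp n) (h : QH) :
    (rightCoeff c n A).1 h = A.1 h * c := rfl

/-- The operator `∂_i ∘ ∂_j`, which is a left `ℍ`-basis of the symbols of order two. -/
def partialIJ : DiffOp 2 := comp 1 1 (partialD 0) (partialD 1)

theorem partialIJ_apply (h : QH) : partialIJ.1 h = (h.imK : QH) := partialI_partialJ h

/-- The right coefficient of `∂_i ∘ ∂_j` in the expansion of an endomorphism of `ℍ` in partial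
derivatives; it is the obstruction for the endomorphism to have order one. -/
def secondCoeff : (QH →ₗ[ℝ] QH) →ₗ[ℝ] QH where
  toFun A := A qk + qj * A qi - qi * A qj + qk * A 1
  map_add' A B := by simp only [LinearMap.add_apply, mul_add]; abel
  map_smul' c A := by
    simp only [LinearMap.smul_apply, mul_smul_comm, smul_add, smul_sub, RingHom.id_apply]

theorem secondCoeff_apply (A : QH →ₗ[ℝ] QH) :
    secondCoeff A = A qk + qj * A qi - qi * A qj + qk * A 1 := rfl

theorem secondCoeff_comp (ψ : QH →ₗ[QH] QH) (A : QH →ₗ[ℝ] QH) :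
    secondCoeff (ψ.restrictScalars ℝ ∘ₗ A) = ψ (secondCoeff A) := by
  simp only [secondCoeff_apply, map_add, map_sub, LinearMap.comp_apply,
    LinearMap.restrictScalars_apply, ← smul_eq_mul, map_smul]

theorem secondCoeff_partialIJ : secondCoeff partialIJ.1 = 1 := by
  simp [secondCoeff_apply, partialIJ_apply, qi, qj, qk]

theorem taylor_expansion (A : QH →ₗ[ℝ] QH) :
    A = (rightMulOp (A 1)).1 + (rightCoeff (A qi - qi * A 1) 1 (partialD 0)).1 +
      (rightCoeff (A qj - qj * A 1) 1 (partialD 1)).1 +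
      (rightCoeff (secondCoeff A) 2 partialIJ).1 := by
  refine LinearMap.ext fun h => ?_
  rw [map_eq_sum_units A h]
  change _ = h * A 1 + partialI h * (A qi - qi * A 1) + partialJ h * (A qj - qj * A 1) +
    partialIJ.1 h * secondCoeff A
  rw [partialIJ_apply, secondCoeff_apply]
  apply Quaternion.ext <;> simp [partialI_apply, partialJ_apply, qi, qj, qk] <;> ring

end Operators

section JetRelation

variable {E : Type} [AddCommGroup E] [Module QH E]

theorem incl_d_tmul (a : QH) (e : E) :
    J1.incl (OmT.tmul (d a) e) = J1.prolong (a • e) - a • J1.prolong e := by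
  ext1 <;> simp

theorem d_qj_tmul_smul (e : E) : OmT.tmul (d qj) (qi • e) = -(qi • OmT.tmul dj e) := by
  have twist_qi : twist qi = -qi := by apply Quaternion.ext <;> simp [twist_apply, qi]
  rw [d_qj, ← OmT.op_smul_tmul, op_dj, OmT.smul_tmul, twist_qi, neg_smul]

theorem d_qi_tmul_smul (e : E) : OmT.tmul (d qi) (qj • e) = -(qj • OmT.tmul di e) := by
  have twist_qj : twist qj = -qj := by apply Quaternion.ext <;> simp [twist_apply, qj]
  rw [d_qi, ← OmT.op_smul_tmul, op_di, OmT.smul_tmul, twist_qj, neg_smul]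

/-- The relation in the 1-jets that encodes `dk = -j di + i dj`. -/
theorem prolong_relation (e : E) :
    J1.prolong (qk • e) + qj • J1.prolong (qi • e) - qi • J1.prolong (qj • e) +
      qk • J1.prolong e = 0 := by
  ext1
  · simp only [map_add, map_sub, map_zero, J1.form_smul, J1.form_prolong, J1.pt_prolong,
      smul_zero, d_qj_tmul_smul, d_qi_tmul_smul, d_qk, OmT.add_tmul, OmT.neg_tmul,
      OmT.smul_tmul]
    abel
  · simp only [map_add, map_sub, map_zero, J1.pt_smul, J1.pt_prolong, smul_smul, qi_mul_qj,
      qj_mul_qi, neg_smul]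
    abel

/-- The combination of jets of units on which every left linear lift of an operator takes the
value `secondCoeff`. -/
def jetRelation (n : ℕ) : Jet QH n :=
  jet n qk + qj • jet n qi - qi • jet n qj + qk • jet n 1

theorem lift_jetRelation {n : ℕ} {A : DiffOp n} {φ : Jet QH n →ₗ[QH] QH} (hφ : IsLift n A φ) :
    φ (jetRelation n) = secondCoeff A.1 := by
  simp only [jetRelation, secondCoeff_apply, map_add, map_sub, map_smul, hφ _, smul_eq_mul]

theorem jetRelation_one : jetRelation 1 = 0 := by
  have relation := prolong_relation (1 : QH)
  simp only [smul_eq_mul, mul_one] at relation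
  exact relation

theorem iota1_d (h : QH) : iota1 (d h) = J1.prolong h - h • J1.prolong 1 := by
  have incl_d := incl_d_tmul h (1 : QH)
  rwa [smul_eq_mul, mul_one] at incl_d

theorem iota2_metric : iota2 ⟨metric, metric_mem⟩ = jetRelation 2 := by
  have incl_tmul (a b : QH) : J1.incl (OmT.map iota1 (OmT.tmul (d a) (d b))) =
      J1.prolong (a • J1.prolong b) - J1.prolong ((a * b) • J1.prolong 1) -
        a • J1.prolong (J1.prolong b) + a • J1.prolong (b • J1.prolong 1) := by
    rw [OmT.map_tmul, incl_d_tmul, iota1_d, smul_sub, smul_smul, map_sub, map_sub, smul_sub]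
    abel
  apply Subtype.ext
  change J1.incl (OmT.map iota1 metric) =
    J1.prolong (J1.prolong qk) + qj • J1.prolong (J1.prolong qi) -
      qi • J1.prolong (J1.prolong qj) + qk • J1.prolong (J1.prolong 1)
  have relation_prolong := prolong_relation (J1.prolong (1 : QH))
  have prolong_relation_one := congrArg J1.prolong (prolong_relation (1 : QH))
  simp only [smul_eq_mul, mul_one, map_add, map_sub, map_zero] at prolong_relation_one
  rw [metric, ← d_qi, ← d_qj, map_sub, map_sub, incl_tmul, incl_tmul, qi_mul_qj, qj_mul_qi,
    neg_smul, map_neg]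
  linear_combination (norm := abel) -relation_prolong - prolong_relation_one

end JetRelation

section LeviCivita

theorem nabla_d (h : QH) : levi.nabla (d h) = (h.imK : QH) • metric := by
  have d_partialI : d (partialI h) = -((h.imK : QH) • dj) := by
    ext1 <;> apply Quaternion.ext <;> simp [partialI_apply, partialJ_apply, dj]
  have d_partialJ : d (partialJ h) = (h.imK : QH) • di := by
    ext1 <;> apply Quaternion.ext <;> simp [partialI_apply, partialJ_apply, di]
  change OmT.tmul (d (partialI h)) di + OmT.tmul (d (partialJ h)) dj = _
  rw [d_partialI, d_partialJ, OmT.neg_tmul, OmT.smul_tmul, OmT.smul_tmul, metric, smul_sub]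
  abel

theorem braiding_metric : braiding metric = metric := by
  rw [metric, map_sub, braiding_tmul, braiding_tmul, tw_di, tw_dj]
  simp [di, dj]
  abel

theorem s11_nabla_d (h : QH) :
    s11 (levi.nabla (d h)) = (h.imK : QH) • (⟨metric, metric_mem⟩ : S2) := by
  have : CharZero QH := algebraRat.charZero QH
  apply Subtype.ext
  change (2 : QH)⁻¹ • (levi.nabla (d h) + braiding (levi.nabla (d h))) = (h.imK : QH) • metric
  rw [nabla_d, map_smul, braiding_metric, ← two_smul QH, smul_smul, inv_mul_cancel₀ two_ne_zero,
    one_smul]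

end LeviCivita

section Filtration

theorem eq_rightMulOp_of_mem {A : QH →ₗ[ℝ] QH} (hA : A ∈ DiffOp 0) : A = (rightMulOp (A 1)).1 := by
  obtain ⟨φ, hφ⟩ := hA
  refine LinearMap.ext fun h => ?_
  have lift_smul : φ (h • jet 0 1) = h * φ (jet 0 1) := map_smul φ h _
  have smul_jet : h • jet 0 (1 : QH) = jet 0 h := mul_one h
  rw [rightMulOp_apply, ← hφ, ← hφ, ← smul_jet, lift_smul]

theorem mem_diffOp_one_iff {A : QH →ₗ[ℝ] QH} : A ∈ DiffOp 1 ↔ secondCoeff A = 0 := by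
  refine ⟨fun hA => ?_, fun hA => ?_⟩
  · obtain ⟨φ, hφ⟩ := hA
    rw [← lift_jetRelation (A := ⟨A, φ, hφ⟩) hφ, jetRelation_one, map_zero]
  · rw [taylor_expansion A, hA]
    refine add_mem (add_mem (add_mem (DiffOp.le_succ 0 (rightMulOp _).2) (rightCoeff _ 1 _).2)
      (rightCoeff _ 1 _).2) ?_
    have : (rightCoeff 0 2 partialIJ).1 = 0 := LinearMap.ext fun h => mul_zero _
    exact this ▸ zero_mem _

theorem diffOp_eq_top {n : ℕ} (hn : 2 ≤ n) : DiffOp n = ⊤ := by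
  refine top_unique fun A _ => DiffOp.mono hn ?_
  rw [taylor_expansion A]
  exact add_mem (add_mem (add_mem (DiffOp.mono (Nat.zero_le 2) (rightMulOp _).2)
    (DiffOp.le_succ 1 (rightCoeff _ 1 _).2)) (DiffOp.le_succ 1 (rightCoeff _ 1 _).2))
    (rightCoeff _ 2 _).2

end Filtration

section Symbols

theorem symb_surjective (n : ℕ) : Function.Surjective (symb n) := Submodule.mkQ_surjective _

theorem symb_eq_zero_iff {n : ℕ} {A : DiffOp n} : symb n A = 0 ↔ A.1 ∈ lowerOrder n :=
  Submodule.Quotient.mk_eq_zero (symbKer n)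

theorem symb_zero_injective : Function.Injective (symb 0) :=
  (injective_iff_map_eq_zero _).2 fun _ hA => Subtype.ext (symb_eq_zero_iff.1 hA)

theorem mem_lowerOrder_of_lt {m n : ℕ} (h : m < n) {A : QH →ₗ[ℝ] QH} (hA : A ∈ DiffOp m) :
    A ∈ lowerOrder n := by
  obtain ⟨k, rfl⟩ := Nat.exists_eq_add_of_lt h
  exact DiffOp.mono (Nat.le_add_right m k) hA

/-- The symbol of order `n` of an operator, as an element of the symbol algebra. -/
def gradedSymb (n : ℕ) : DiffOp n →ₗ[ℝ] SymbAlg := inDeg n ∘ₗ symb n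

theorem gradedSymb_congr {n m : ℕ} (h : n = m) {A : DiffOp n} {B : DiffOp m} (hAB : A.1 = B.1) :
    gradedSymb n A = gradedSymb m B := by
  subst h
  rw [Subtype.ext hAB]

end Symbols

namespace FullQuantization

variable (Q : FullQuantization)

theorem q_zero_symb (A : DiffOp 0) : Q.q 0 (symb 0 A) = A := symb_zero_injective (Q.symb_q 0 _)

/-- An operator is homogeneous of order `n` for a quantization if it is in the image of `qⁿ`, that
is, if it is the quantization of its own symbol. -/
def IsHomogeneous {n : ℕ} (A : DiffOp n) : Prop := Q.q n (symb n A) = A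

theorem isHomogeneous_zero (n : ℕ) : Q.IsHomogeneous (0 : DiffOp n) :=
  (congrArg (Q.q n) (map_zero _)).trans (map_zero _)

theorem isHomogeneous_q (n : ℕ) (σ : Symb n) : Q.IsHomogeneous (Q.q n σ) :=
  congrArg (Q.q n) (Q.symb_q n σ)

variable {Q} in
theorem IsHomogeneous.rightCoeff {n : ℕ} {A : DiffOp n} (hA : Q.IsHomogeneous A) (c : QH) :
    Q.IsHomogeneous (rightCoeff c n A) :=
  (Q.q_postComp _ n A).trans (congrArg _ hA)

theorem truncStep_val_of_mem {n : ℕ} {A : DiffOp (n + 1)} (hA : A.1 ∈ DiffOp n) :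
    (Q.truncStep n A).1 = A.1 := by
  change A.1 - (Q.q (n + 1) (symb (n + 1) A)).1 = A.1
  rw [symb_eq_zero_iff.2 (mem_lowerOrder_of_lt n.lt_succ_self hA), map_zero]
  exact sub_zero _

theorem truncAux_val_of_mem {k r : ℕ} {A : DiffOp (k + r)} (hA : A.1 ∈ DiffOp k) :
    (Q.truncAux k r A).1 = A.1 := by
  induction r with
  | zero => rfl
  | succ r ih =>
    have step_val : (Q.truncStep (k + r) A).1 = A.1 :=
      Q.truncStep_val_of_mem (DiffOp.mono (Nat.le_add_right k r) hA)
    exact (ih (step_val ▸ hA)).trans step_val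

theorem truncAux_eq_zero {k r m : ℕ} (hkm : k < m) (hmr : m ≤ k + r) {A : DiffOp (k + r)}
    {B : DiffOp m} (hB : Q.IsHomogeneous B) (hAB : A.1 = B.1) : Q.truncAux k r A = 0 := by
  induction r with
  | zero => exact absurd hkm hmr.not_gt
  | succ r ih =>
    change Q.truncAux k r (Q.truncStep (k + r) A) = 0
    obtain hmr | rfl := Nat.le_or_eq_of_le_succ hmr
    · have hA : A.1 ∈ DiffOp (k + r) := DiffOp.mono hmr (hAB ▸ B.2)
      exact ih hmr ((Q.truncStep_val_of_mem hA).trans hAB)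
    · obtain rfl : A = B := Subtype.ext hAB
      have step_zero : Q.truncStep (k + r) A = 0 :=
        Subtype.ext (sub_eq_zero.2 (congrArg Subtype.val hB).symm)
      rw [step_zero, map_zero]

theorem symbComp_self {N m : ℕ} {A : DiffOp N} {B : DiffOp m} (hAB : A.1 = B.1) :
    Q.symbComp N m A = symb m B :=
  congrArg (symb m) (Subtype.ext ((Q.truncAux_val_of_mem (hAB ▸ B.2)).trans hAB))

theorem symbComp_of_ne {N k m : ℕ} (hm : m ≤ N) (hkm : k ≠ m) {A : DiffOp N} {B : DiffOp m}
    (hB : Q.IsHomogeneous B) (hAB : A.1 = B.1) : Q.symbComp N k A = 0 := by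
  obtain hkm | hmk := hkm.lt_or_gt
  · exact (congrArg (symb k) (Q.truncAux_eq_zero hkm (hm.trans (Nat.le_add_left N k)) hB hAB)).trans
      (map_zero _)
  · have hA : A.1 ∈ DiffOp m := hAB ▸ B.2
    have trunc_val : (Q.trunc N k A).1 = A.1 := Q.truncAux_val_of_mem (DiffOp.mono hmk.le hA)
    exact symb_eq_zero_iff.2 (trunc_val ▸ mem_lowerOrder_of_lt hmk hA)

/-- The map `∑ₗ qˡ(σₗ) ↦ ∑ₗ ħᴺ⁻ˡ σₗ` on operators of order at most `N`, which turns the composition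
of quantized symbols into their star product. -/
def hbarSymb (ħ : ℝ) (N : ℕ) : DiffOp N →ₗ[ℝ] SymbAlg :=
  ∑ k ∈ Finset.range (N + 1), ħ ^ k • inDeg (N - k) ∘ₗ Q.symbComp N (N - k)

theorem hbarSymb_eq_smul (ħ : ℝ) {N m : ℕ} (hm : m ≤ N) {A : DiffOp N} {B : DiffOp m}
    (hB : Q.IsHomogeneous B) (hAB : A.1 = B.1) :
    Q.hbarSymb ħ N A = ħ ^ (N - m) • gradedSymb m B := by
  simp only [hbarSymb, LinearMap.sum_apply, LinearMap.smul_apply, LinearMap.comp_apply]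
  rw [Finset.sum_eq_single_of_mem (N - m) (Finset.mem_range.2 (by omega)) fun k hk hkm => ?_,
    Nat.sub_sub_self hm, Q.symbComp_self hAB]
  · rfl
  · rw [Finset.mem_range] at hk
    rw [Q.symbComp_of_ne hm (by omega) hB hAB, map_zero, smul_zero]

theorem star_gradedSymb (ħ : ℝ) {n m : ℕ} {A : DiffOp n} {B : DiffOp m}
    (hA : Q.IsHomogeneous A) (hB : Q.IsHomogeneous B) :
    Q.star ħ (gradedSymb n A) (gradedSymb m B) = Q.hbarSymb ħ (n + m) (comp n m A B) := by
  refine (bilinExt_inDeg _ n m _ _).trans ?_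
  change Q.hbarSymb ħ (n + m) (comp n m (Q.q n (symb n A)) (Q.q m (symb m B))) = _
  rw [hA, hB]

theorem star_gradedSymb_of_comp_eq (ħ : ℝ) {n m N : ℕ} (hN : N = n + m) {A : DiffOp n}
    {B : DiffOp m} {C : DiffOp N} (hA : Q.IsHomogeneous A) (hB : Q.IsHomogeneous B)
    (hC : Q.IsHomogeneous C) (hABC : A.1 ∘ₗ B.1 = C.1) :
    Q.star ħ (gradedSymb n A) (gradedSymb m B) = gradedSymb N C := by
  subst hN
  rw [Q.star_gradedSymb ħ hA hB, Q.hbarSymb_eq_smul ħ le_rfl hC hABC, Nat.sub_self, pow_zero,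
    one_smul]

theorem star_zero : Q.star 0 = symbMul := by
  refine congrArg bilinExt (funext₂ fun n m => LinearMap.ext₂ fun σ τ => ?_)
  rw [starHom_apply, Finset.sum_range_succ', Finset.sum_eq_zero fun k _ => by simp, zero_add,
    pow_zero, one_smul, Nat.sub_zero, Q.symbComp_self rfl, ← symbMulHom_symb, Q.symb_q, Q.symb_q]
  rfl

end FullQuantization

section InducedQuantization

/-- The homogeneous part of order `n` of an operator of order at most `n`: what remains of its
expansion in partial derivatives after the terms of lower order are dropped. -/
def leadingPart : (n : ℕ) → DiffOp n →ₗ[ℝ] DiffOp n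
  | 0 => LinearMap.id
  | 1 =>
    { toFun := fun A => A - ⟨(rightMulOp (A.1 1)).1, DiffOp.le_succ 0 (rightMulOp _).2⟩
      map_add' := fun A B => Subtype.ext (LinearMap.ext fun h => by
        change A.1 h + B.1 h - h * (A.1 1 + B.1 1) = A.1 h - h * A.1 1 + (B.1 h - h * B.1 1)
        rw [mul_add, add_sub_add_comm])
      map_smul' := fun c A => Subtype.ext (LinearMap.ext fun h => by
        change c • A.1 h - h * (c • A.1 1) = c • (A.1 h - h * A.1 1)
        rw [mul_smul_comm, smul_sub]) }
  | 2 =>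
    { toFun := fun A => rightCoeff (secondCoeff A.1) 2 partialIJ
      map_add' := fun A B => Subtype.ext (LinearMap.ext fun h =>
        (congrArg (partialIJ.1 h * ·) (map_add secondCoeff A.1 B.1)).trans (mul_add _ _ _))
      map_smul' := fun c A => Subtype.ext (LinearMap.ext fun h =>
        (congrArg (partialIJ.1 h * ·) (map_smul secondCoeff c A.1)).trans (mul_smul_comm _ _ _)) }
  | _ + 3 => 0

theorem leadingPart_one_apply (A : DiffOp 1) (h : QH) :
    (leadingPart 1 A).1 h = A.1 h - h * A.1 1 := rfl

theorem leadingPart_one_eq (A : DiffOp 1) :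
    leadingPart 1 A = rightCoeff (A.1 qi - qi * A.1 1) 1 (partialD 0) +
      rightCoeff (A.1 qj - qj * A.1 1) 1 (partialD 1) := by
  refine Subtype.ext (LinearMap.ext fun h => (leadingPart_one_apply A h).trans ?_)
  have taylor := LinearMap.congr_fun (taylor_expansion A.1) h
  rw [mem_diffOp_one_iff.1 A.2] at taylor
  rw [taylor]
  change h * A.1 1 + _ + _ + partialIJ.1 h * 0 - h * A.1 1 = _ + _
  rw [mul_zero]
  abel

theorem leadingPart_two_apply (A : DiffOp 2) (h : QH) :
    (leadingPart 2 A).1 h = h.imK * secondCoeff A.1 := by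
  rw [← partialIJ_apply]
  rfl

theorem leadingPart_eq_zero {n : ℕ} {A : DiffOp n} (hA : A.1 ∈ lowerOrder n) :
    leadingPart n A = 0 := by
  refine Subtype.ext (LinearMap.ext fun h => ?_)
  match n with
  | 0 => exact LinearMap.congr_fun hA h
  | 1 => exact sub_eq_zero.2 (LinearMap.congr_fun (eq_rightMulOp_of_mem hA) h)
  | 2 =>
    rw [leadingPart_two_apply, mem_diffOp_one_iff.1 hA, mul_zero]
    rfl
  | _ + 3 => rfl

theorem sub_leadingPart_mem {n : ℕ} (A : DiffOp n) : (A - leadingPart n A).1 ∈ lowerOrder n := by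
  match n with
  | 0 => exact sub_self A.1
  | 1 =>
    have : (A - leadingPart 1 A).1 = (rightMulOp (A.1 1)).1 := sub_sub_cancel _ _
    exact this ▸ (rightMulOp (A.1 1)).2
  | 2 =>
    refine mem_diffOp_one_iff.2 ((map_sub secondCoeff _ _).trans (sub_eq_zero.2 ?_))
    refine Eq.symm ((secondCoeff_comp _ partialIJ.1).trans ?_)
    rw [secondCoeff_partialIJ]
    exact one_mul _
  | n + 3 =>
    change _ ∈ DiffOp (n + 2)
    rw [diffOp_eq_top (Nat.le_add_left 2 n)]
    trivial

theorem symb_leadingPart {n : ℕ} (A : DiffOp n) : symb n (leadingPart n A) = symb n A :=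
  (sub_eq_zero.1 ((map_sub _ _ _).symm.trans (symb_eq_zero_iff.2 (sub_leadingPart_mem A)))).symm

theorem gradedSymb_eq_leadingPart {n : ℕ} (A : DiffOp n) :
    gradedSymb n A = gradedSymb n (leadingPart n A) :=
  congrArg (inDeg n) (symb_leadingPart A).symm

theorem leadingPart_postComp (ψ : QH →ₗ[QH] QH) (n : ℕ) (A : DiffOp n) :
    leadingPart n (postComp ψ n A) = postComp ψ n (leadingPart n A) := by
  refine Subtype.ext (LinearMap.ext fun h => ?_)
  have map_mul_left (a b : QH) : ψ (a * b) = a * ψ b := map_smul ψ a b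
  match n with
  | 0 => rfl
  | 1 => exact (congrArg (ψ (A.1 h) - ·) (map_mul_left h _).symm).trans (map_sub ψ _ _).symm
  | 2 =>
    rw [leadingPart_two_apply]
    refine (congrArg (_ * ·) (secondCoeff_comp ψ A.1)).trans ?_
    exact (map_mul_left _ _).symm.trans (congrArg ψ (leadingPart_two_apply A h).symm)
  | _ + 3 => exact (map_zero ψ).symm

/-- The quantization that represents each symbol by its homogeneous operator. -/
def leadingQuantization : FullQuantization where
  q n := Submodule.liftQ (symbKer n) (leadingPart n) fun _ hA => leadingPart_eq_zero hA
  symb_q n σ := by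
    obtain ⟨A, rfl⟩ := symb_surjective n σ
    exact symb_leadingPart A
  q_postComp := leadingPart_postComp

theorem lift_iota1_d {A : DiffOp 1} {φ : Jet QH 1 →ₗ[QH] QH} (hφ : IsLift 1 A φ) (h : QH) :
    φ (iota1 (d h)) = (leadingPart 1 A).1 h := by
  rw [leadingPart_one_apply, ← hφ, ← hφ, iota1_d]
  exact (map_sub φ _ _).trans (congrArg _ (map_smul φ _ _))

theorem lift_iota2_s11_nabla_d {A : DiffOp 2} {φ : Jet QH 2 →ₗ[QH] QH} (hφ : IsLift 2 A φ)
    (h : QH) : φ (iota2 (s11 (levi.nabla (d h)))) = (leadingPart 2 A).1 h := by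
  rw [leadingPart_two_apply, s11_nabla_d, map_smul, map_smul, iota2_metric, lift_jetRelation hφ,
    smul_eq_mul]

theorem isInduced_iff (Q : FullQuantization) :
    IsInduced Q ↔ ∀ n A, Q.q n (symb n A) = leadingPart n A := by
  refine ⟨fun hQ n A => ?_, fun hQ => ⟨hQ 0, fun A φ hφ h => ?_, fun A φ hφ h => ?_, ?_⟩⟩
  · obtain ⟨φ, hφ⟩ := A.2
    refine Subtype.ext (LinearMap.ext fun h => ?_)
    match n with
    | 0 => exact congrArg (·.1 h) (hQ.q_zero A)
    | 1 => exact (hQ.q_one A φ hφ h).trans (lift_iota1_d hφ h)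
    | 2 => exact (hQ.q_two A φ hφ h).trans (lift_iota2_s11_nabla_d hφ h)
    | n + 3 => rw [hQ.q_ge_three _ (Nat.le_add_left 3 n)]; rfl
  · rw [hQ, lift_iota1_d hφ]
  · rw [hQ, lift_iota2_s11_nabla_d hφ]
  · intro n hn
    obtain ⟨n, rfl⟩ := Nat.exists_eq_add_of_le' hn
    refine LinearMap.ext fun σ => ?_
    obtain ⟨A, rfl⟩ := symb_surjective _ σ
    exact hQ (n + 3) A

theorem existsUnique_isInduced : ∃! Q : FullQuantization, IsInduced Q := by
  refine ⟨leadingQuantization, (isInduced_iff _).2 fun _ _ => rfl,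
    fun ⟨q, symb_q, q_postComp⟩ hQ => ?_⟩
  obtain rfl : q = leadingQuantization.q := funext fun n => LinearMap.ext fun σ => by
    obtain ⟨A, rfl⟩ := symb_surjective n σ
    exact (isInduced_iff _).1 hQ n A
  rfl

variable {Q : FullQuantization}

theorem isHomogeneous_of_eval_one (hQ : IsInduced Q) {A : DiffOp 1} (hA : A.1 1 = 0) :
    Q.IsHomogeneous A := by
  refine ((isInduced_iff Q).1 hQ 1 A).trans (Subtype.ext (LinearMap.ext fun h => ?_))
  rw [leadingPart_one_apply, hA, mul_zero, sub_zero]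

theorem isHomogeneous_partialIJ (hQ : IsInduced Q) : Q.IsHomogeneous partialIJ := by
  refine ((isInduced_iff Q).1 hQ 2 partialIJ).trans (Subtype.ext (LinearMap.ext fun h => ?_))
  rw [leadingPart_two_apply, secondCoeff_partialIJ, mul_one, partialIJ_apply]

end InducedQuantization

section GeneratedSubalgebra

variable {μ ν : SymbAlg →ₗ[ℝ] SymbAlg →ₗ[ℝ] SymbAlg} {S T : Set SymbAlg}

theorem symbOne_mem_genSubalg : symbOne ∈ genSubalg μ S :=
  Submodule.mem_sInf.2 fun _ hN => hN.1

theorem subset_genSubalg : S ⊆ genSubalg μ S := fun _ hs =>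
  Submodule.mem_sInf.2 fun _ hN => hN.2.1 hs

theorem mul_mem_genSubalg {u v : SymbAlg} (hu : u ∈ genSubalg μ S) (hv : v ∈ genSubalg μ S) :
    μ u v ∈ genSubalg μ S :=
  Submodule.mem_sInf.2 fun N hN =>
    hN.2.2 u (Submodule.mem_sInf.1 hu N hN) v (Submodule.mem_sInf.1 hv N hN)

theorem genSubalg_le {N : Submodule ℝ SymbAlg} (one_mem : symbOne ∈ N) (hS : S ⊆ N)
    (mul_mem : ∀ u ∈ N, ∀ v ∈ N, μ u v ∈ N) : genSubalg μ S ≤ N :=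
  sInf_le ⟨one_mem, hS, mul_mem⟩

theorem genSubalg_eq_span (one_mem : symbOne ∈ T) (hST : S ⊆ T) (hT : T ⊆ genSubalg μ S)
    (mul_mem : ∀ u ∈ T, ∀ v ∈ T, μ u v ∈ T) : genSubalg μ S = Submodule.span ℝ T := by
  refine le_antisymm (genSubalg_le (Submodule.subset_span one_mem)
    (hST.trans Submodule.subset_span) fun u hu v hv => ?_) (Submodule.span_le.2 hT)
  have map₂_le : Submodule.map₂ μ (Submodule.span ℝ T) (Submodule.span ℝ T) ≤
      Submodule.span ℝ T := by
    rw [Submodule.map₂_span_span, Submodule.span_le]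
    rintro _ ⟨u, hu, v, hv, rfl⟩
    exact Submodule.subset_span (mul_mem u hu v hv)
  exact map₂_le (Submodule.apply_mem_map₂ μ hu hv)

theorem eqOn_span₂ (h : ∀ u ∈ T, ∀ v ∈ T, μ u v = ν u v) {u v : SymbAlg}
    (hu : u ∈ Submodule.span ℝ T) (hv : v ∈ Submodule.span ℝ T) : μ u v = ν u v := by
  refine LinearMap.eqOn_span (f := μ.flip v) (g := ν.flip v) (fun x hx => ?_) hu
  exact LinearMap.eqOn_span (f := μ x) (g := ν x) (fun y hy => h x hx y hy) hv

end GeneratedSubalgebra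

section Positions

/-- The symbol of order zero of the right multiplication by `c`. -/
def posSymb : QH →ₗ[ℝ] SymbAlg where
  toFun c := gradedSymb 0 (rightMulOp c)
  map_add' a b := by
    rw [← map_add]
    exact congrArg _ (Subtype.ext (LinearMap.ext fun h => mul_add h a b))
  map_smul' r a := by
    rw [← map_smul]
    exact congrArg _ (Subtype.ext (LinearMap.ext fun h => mul_smul_comm r h a))

theorem posSymb_injective : Function.Injective posSymb := fun a b hab => by
  have op_eq : rightMulOp a = rightMulOp b :=
    symb_zero_injective (DirectSum.of_injective (β := Symb) 0 hab)
  simpa only [rightMulOp_apply, one_mul] using congrArg (fun A => A.1 1) op_eq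

variable (Q : FullQuantization) (ħ : ℝ)

theorem posSymb_star (c : QH) (n : ℕ) (A : DiffOp n) :
    Q.star ħ (posSymb c) (gradedSymb n A) = gradedSymb n (rightCoeff c n A) := by
  set B : DiffOp n := Q.q n (symb n A)
  have symb_B : gradedSymb n B = gradedSymb n A := congrArg (inDeg n) (Q.symb_q n _)
  have symb_rightCoeff : gradedSymb n (rightCoeff c n A) = gradedSymb n (rightCoeff c n B) :=
    congrArg (inDeg n) ((Q.symb_q n _).symm.trans (congrArg (symb n) (Q.q_postComp _ n A)))
  have hB : Q.IsHomogeneous B := Q.isHomogeneous_q n _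
  rw [← symb_B, symb_rightCoeff]
  exact Q.star_gradedSymb_of_comp_eq ħ (zero_add n).symm (Q.q_zero_symb _) hB (hB.rightCoeff c) rfl

theorem posSymb_star_posSymb (a b : QH) :
    Q.star ħ (posSymb a) (posSymb b) = posSymb (b * a) :=
  (posSymb_star Q ħ a 0 _).trans
    (congrArg _ (Subtype.ext (LinearMap.ext fun h => mul_assoc h b a)))

theorem posSymb_mem_genSubalg {S : Set SymbAlg} (hS : Set.range symbX ⊆ S) (c : QH) :
    posSymb c ∈ genSubalg (Q.star ħ) S := by
  have symbX_mem (a : Fin 2) : posSymb (unitQ a) ∈ genSubalg (Q.star ħ) S :=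
    subset_genSubalg (hS ⟨a, rfl⟩)
  have posSymb_qk_mem : posSymb qk ∈ genSubalg (Q.star ħ) S := by
    rw [← qi_mul_qj, ← posSymb_star_posSymb Q ħ]
    exact mul_mem_genSubalg (symbX_mem 1) (symbX_mem 0)
  rw [map_eq_sum_units posSymb c]
  exact add_mem (add_mem (add_mem (Submodule.smul_mem _ _ symbOne_mem_genSubalg)
    (Submodule.smul_mem _ _ (symbX_mem 0))) (Submodule.smul_mem _ _ (symbX_mem 1)))
    (Submodule.smul_mem _ _ posSymb_qk_mem)

theorem genSubalg_symbX :
    genSubalg (Q.star ħ) (Set.range symbX) = LinearMap.range posSymb := by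
  refine le_antisymm (genSubalg_le ⟨1, rfl⟩ ?_ ?_) ?_
  · rintro _ ⟨a, rfl⟩
    exact ⟨unitQ a, rfl⟩
  · rintro _ ⟨a, rfl⟩ _ ⟨b, rfl⟩
    exact ⟨b * a, (posSymb_star_posSymb Q ħ a b).symm⟩
  · rintro _ ⟨c, rfl⟩
    exact posSymb_mem_genSubalg Q ħ subset_rfl c

theorem exists_opEquiv_genSubalg_symbX :
    ∃ f : QHᵐᵒᵖ ≃ₗ[ℝ] genSubalg (Q.star ħ) (Set.range symbX),
      (f 1 : SymbAlg) = symbOne ∧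
      ∀ u v : QHᵐᵒᵖ, (f (u * v) : SymbAlg) = Q.star ħ (f u) (f v) :=
  ⟨(MulOpposite.opLinearEquiv ℝ).symm ≪≫ₗ LinearEquiv.ofInjective posSymb posSymb_injective ≪≫ₗ
    LinearEquiv.ofEq _ _ (genSubalg_symbX Q ħ).symm, rfl,
    fun u v => (posSymb_star_posSymb Q ħ u.unop v.unop).symm⟩

theorem genSubalg_symbX_independent (ħ' : ℝ) :
    genSubalg (Q.star ħ) (Set.range symbX) = genSubalg (Q.star ħ') (Set.range symbX) ∧
      ∀ u ∈ genSubalg (Q.star ħ) (Set.range symbX),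
      ∀ v ∈ genSubalg (Q.star ħ) (Set.range symbX), Q.star ħ u v = Q.star ħ' u v := by
  simp only [genSubalg_symbX, true_and]
  rintro _ ⟨a, rfl⟩ _ ⟨b, rfl⟩
  rw [posSymb_star_posSymb, posSymb_star_posSymb]

end Positions

section Momenta

theorem partialD_mul (a : Fin 2) (h c : QH) :
    (partialD a).1 (h * c) = h * (partialD a).1 c + (partialD a).1 h * twist c := by
  fin_cases a
  exacts [partialI_mul h c, partialJ_mul h c]

theorem partialD_one (a : Fin 2) : (partialD a).1 1 = 0 := by
  fin_cases a
  exacts [congrArg Om.ci d_one, congrArg Om.cj d_one]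

theorem partialD_unitQ (a b : Fin 2) : (partialD a).1 (unitQ b) = if a = b then 1 else 0 := by
  fin_cases a <;> fin_cases b
  exacts [congrArg Om.ci d_qi, congrArg Om.ci d_qj, congrArg Om.cj d_qi, congrArg Om.cj d_qj]

theorem twist_unitQ (a : Fin 2) : twist (unitQ a) = -unitQ a := by
  fin_cases a <;> apply Quaternion.ext <;> simp [twist_apply, unitQ, qi, qj]

theorem partialD_imK (a : Fin 2) (h : QH) : ((partialD a).1 h).imK = 0 := by
  fin_cases a <;> rfl

theorem partialD_partialD (a b : Fin 2) (h : QH) :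
    (partialD a).1 ((partialD b).1 h) = h.imK * (partialD a).1 ((partialD b).1 qk) := by
  fin_cases a <;> fin_cases b <;> apply Quaternion.ext <;>
    simp [partialD, partialI_apply, partialJ_apply, qk]

theorem partialD_anticomm (a b : Fin 2) (h : QH) :
    (partialD a).1 ((partialD b).1 h) = -(partialD b).1 ((partialD a).1 h) := by
  fin_cases a <;> fin_cases b <;> apply Quaternion.ext <;>
    simp [partialD, partialI_apply, partialJ_apply]

/-- The composition `∂_{a₁} ∘ ⋯ ∘ ∂_{aₙ}` for a word `a₁ … aₙ` in the indices `i, j`. -/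
def momentumOp : (w : List (Fin 2)) → DiffOp w.length
  | [] => rightMulOp 1
  | a :: w => ⟨(partialD a).1 ∘ₗ (momentumOp w).1,
      (w.length.add_comm 1 ▸ DiffOp.comp_mem (partialD a).2 (momentumOp w).2 :)⟩

theorem momentumOp_append (v w : List (Fin 2)) :
    (momentumOp (v ++ w)).1 = (momentumOp v).1 ∘ₗ (momentumOp w).1 := by
  induction v with
  | nil => exact LinearMap.ext fun h => (mul_one _).symm
  | cons a v ih => exact congrArg ((partialD a).1 ∘ₗ ·) ih

/-- The symbol of `∂_{a₁} ∘ ⋯ ∘ ∂_{aₙ}`, that is, the ordered product of the momenta. -/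
def momentumSymb (w : List (Fin 2)) : SymbAlg := gradedSymb w.length (momentumOp w)

theorem symbP_eq_momentumSymb (a : Fin 2) : symbP a = momentumSymb [a] :=
  gradedSymb_congr rfl (LinearMap.ext fun h => congrArg (partialD a).1 (mul_one h).symm)

variable {Q : FullQuantization} (hQ : IsInduced Q) (ħ : ℝ)
include hQ

theorem isHomogeneous_partialD (a : Fin 2) : Q.IsHomogeneous (partialD a) :=
  isHomogeneous_of_eval_one hQ (partialD_one a)

theorem isHomogeneous_comp_partialD (a b : Fin 2) :
    Q.IsHomogeneous (comp 1 1 (partialD a) (partialD b)) := by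
  have comp_eq : comp 1 1 (partialD a) (partialD b) =
      rightCoeff ((partialD a).1 ((partialD b).1 qk)) 2 partialIJ :=
    Subtype.ext (LinearMap.ext fun h => by
      rw [rightCoeff_apply, partialIJ_apply]
      exact partialD_partialD a b h)
  exact comp_eq ▸ (isHomogeneous_partialIJ hQ).rightCoeff _

theorem isHomogeneous_momentumOp : ∀ w, Q.IsHomogeneous (momentumOp w)
  | [] => Q.q_zero_symb _
  | [a] => isHomogeneous_of_eval_one hQ
      ((congrArg (partialD a).1 (mul_one 1)).trans (partialD_one a))
  | [a, b] => by
    have op_eq : momentumOp [a, b] = comp 1 1 (partialD a) (partialD b) :=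
      Subtype.ext (LinearMap.ext fun h =>
        congrArg (fun x => (partialD a).1 ((partialD b).1 x)) (mul_one h))
    exact op_eq ▸ isHomogeneous_comp_partialD hQ a b
  | a :: b :: c :: w => by
    have op_eq : momentumOp (a :: b :: c :: w) = 0 :=
      Subtype.ext (LinearMap.ext fun h => (partialD_partialD a b _).trans
        ((congrArg (fun r : ℝ => (r : QH) * _) (partialD_imK c _)).trans (zero_mul _)))
    exact op_eq ▸ Q.isHomogeneous_zero _

theorem momentumSymb_star_momentumSymb (v w : List (Fin 2)) :
    Q.star ħ (momentumSymb v) (momentumSymb w) = momentumSymb (v ++ w) :=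
  Q.star_gradedSymb_of_comp_eq ħ List.length_append (isHomogeneous_momentumOp hQ v)
    (isHomogeneous_momentumOp hQ w) (isHomogeneous_momentumOp hQ _) (momentumOp_append v w).symm

theorem symbP_star_symbP (a b : Fin 2) :
    Q.star ħ (symbP a) (symbP b) = gradedSymb 2 (comp 1 1 (partialD a) (partialD b)) :=
  Q.star_gradedSymb_of_comp_eq ħ rfl (isHomogeneous_partialD hQ a) (isHomogeneous_partialD hQ b)
    (isHomogeneous_comp_partialD hQ a b) rfl

theorem symbP_star_anticomm (a b : Fin 2) :
    Q.star ħ (symbP a) (symbP b) = -Q.star ħ (symbP b) (symbP a) := by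
  rw [symbP_star_symbP hQ, symbP_star_symbP hQ, ← map_neg]
  exact congrArg _ (Subtype.ext (LinearMap.ext (partialD_anticomm a b)))

theorem symbP_star_self (a : Fin 2) : Q.star ħ (symbP a) (symbP a) = 0 := by
  have : IsAddTorsionFree SymbAlg := .of_isTorsionFree ℝ SymbAlg
  exact self_eq_neg.1 (symbP_star_anticomm hQ ħ a a)

theorem genSubalg_symbP : genSubalg (Q.star ħ) (Set.range symbP) =
    Submodule.span ℝ (Set.range momentumSymb) := by
  refine genSubalg_eq_span ⟨[], rfl⟩ ?_ ?_ ?_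
  · rintro _ ⟨a, rfl⟩
    exact ⟨[a], (symbP_eq_momentumSymb a).symm⟩
  · rintro _ ⟨w, rfl⟩
    induction w with
    | nil => exact symbOne_mem_genSubalg
    | cons a w ih =>
      rw [← List.singleton_append, ← momentumSymb_star_momentumSymb hQ ħ, ← symbP_eq_momentumSymb]
      exact mul_mem_genSubalg (subset_genSubalg ⟨a, rfl⟩) ih
  · rintro _ ⟨v, rfl⟩ _ ⟨w, rfl⟩
    exact ⟨v ++ w, (momentumSymb_star_momentumSymb hQ ħ v w).symm⟩

theorem genSubalg_symbP_independent (ħ' : ℝ) :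
    genSubalg (Q.star ħ) (Set.range symbP) = genSubalg (Q.star ħ') (Set.range symbP) ∧
      ∀ u ∈ genSubalg (Q.star ħ) (Set.range symbP),
      ∀ v ∈ genSubalg (Q.star ħ) (Set.range symbP), Q.star ħ u v = Q.star ħ' u v := by
  simp only [genSubalg_symbP hQ, true_and]
  refine fun u hu v hv => eqOn_span₂ ?_ hu hv
  rintro _ ⟨v, rfl⟩ _ ⟨w, rfl⟩
  rw [momentumSymb_star_momentumSymb hQ, momentumSymb_star_momentumSymb hQ]

theorem symbP_star_posSymb (a : Fin 2) (c : QH) : Q.star ħ (symbP a) (posSymb c) =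
    Q.star 0 (posSymb (twist c)) (symbP a) + ħ • posSymb ((partialD a).1 c) := by
  have hP : Q.IsHomogeneous (partialD a) := isHomogeneous_partialD hQ a
  have comp_eq : comp 1 0 (partialD a) (rightMulOp c) =
      rightCoeff (twist c) 1 (partialD a) +
        Submodule.inclusion (DiffOp.le_succ 0) (rightMulOp ((partialD a).1 c)) :=
    Subtype.ext (LinearMap.ext fun h => (partialD_mul a h c).trans (add_comm _ _))
  refine (Q.star_gradedSymb ħ hP (Q.q_zero_symb _)).trans ?_
  rw [comp_eq, map_add, Q.hbarSymb_eq_smul ħ le_rfl (hP.rightCoeff _) rfl,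
    Q.hbarSymb_eq_smul ħ (Nat.zero_le 1) (Q.q_zero_symb _) rfl, pow_zero, one_smul, pow_one]
  exact congrArg (· + _) (posSymb_star Q 0 (twist c) 1 (partialD a)).symm

theorem symbP_star_symbX (a b : Fin 2) : Q.star ħ (symbP a) (symbX b) =
    -Q.star 0 (symbX b) (symbP a) + ħ • (if a = b then symbOne else 0) := by
  refine (symbP_star_posSymb hQ ħ a (unitQ b)).trans ?_
  rw [twist_unitQ, map_neg, map_neg, LinearMap.neg_apply, partialD_unitQ, apply_ite posSymb,
    map_zero]
  rfl

theorem genSubalg_symbX_union_symbP :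
    genSubalg (Q.star ħ) (Set.range symbX ∪ Set.range symbP) = ⊤ := by
  set N := genSubalg (Q.star ħ) (Set.range symbX ∪ Set.range symbP)
  have posSymb_mem (c : QH) : posSymb c ∈ N := posSymb_mem_genSubalg Q ħ Set.subset_union_left c
  have symbP_mem (a : Fin 2) : symbP a ∈ N := subset_genSubalg (Or.inr ⟨a, rfl⟩)
  have gradedSymb_mem (n : ℕ) (A : DiffOp n) : gradedSymb n A ∈ N := by
    rw [gradedSymb_eq_leadingPart]
    match n with
    | 0 =>
      have leadingPart_eq : leadingPart 0 A = rightMulOp (A.1 1) :=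
        Subtype.ext (eq_rightMulOp_of_mem A.2)
      rw [leadingPart_eq]
      exact posSymb_mem (A.1 1)
    | 1 =>
      rw [leadingPart_one_eq, map_add, ← posSymb_star Q ħ, ← posSymb_star Q ħ]
      exact add_mem (mul_mem_genSubalg (posSymb_mem _) (symbP_mem 0))
        (mul_mem_genSubalg (posSymb_mem _) (symbP_mem 1))
    | 2 =>
      have symb_eq : gradedSymb 2 (leadingPart 2 A) = Q.star ħ (posSymb (secondCoeff A.1))
          (Q.star ħ (symbP 0) (symbP 1)) := by
        rw [symbP_star_symbP hQ, posSymb_star]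
        rfl
      rw [symb_eq]
      exact mul_mem_genSubalg (posSymb_mem _) (mul_mem_genSubalg (symbP_mem 0) (symbP_mem 1))
    | n + 3 => exact (map_zero (gradedSymb (n + 3))).symm ▸ zero_mem N
  refine eq_top_iff.2 fun u _ => DirectSum.induction_on u (zero_mem N) (fun n σ => ?_)
    fun _ _ => add_mem
  obtain ⟨A, rfl⟩ := symb_surjective n σ
  exact gradedSymb_mem n A

end Momenta

end QuatQuant

end

theorem proposition5p53 :
    (∃! Q : FullQuantization, IsInduced Q) ∧
    ∀ Q : FullQuantization, IsInduced Q →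
      (∀ ħ : ℝ,
        -- the relations between the generators
        (∀ a b : Fin 2, Q.star ħ (symbX a) (symbX b) = symbMul (symbX a) (symbX b)) ∧
        (∀ a b : Fin 2, Q.star ħ (symbP a) (symbX b) =
          -symbMul (symbX b) (symbP a) + ħ • (if a = b then symbOne else 0)) ∧
        (∀ a b : Fin 2, Q.star ħ (symbX a) (symbP b) = symbMul (symbX a) (symbP b)) ∧
        (∀ a b : Fin 2, Q.star ħ (symbP a) (symbP b) = symbMul (symbP a) (symbP b)) ∧
        -- the `x_a` and `p_a` generate the whole algebra
        genSubalg (Q.star ħ) (Set.range symbX ∪ Set.range symbP) = ⊤ ∧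
        -- the `x_a` generate a subalgebra isomorphic to the opposite quaternions
        (∃ f : QHᵐᵒᵖ ≃ₗ[ℝ] genSubalg (Q.star ħ) (Set.range symbX),
          (f 1 : SymbAlg) = symbOne ∧
          ∀ u v : QHᵐᵒᵖ, (f (u * v) : SymbAlg) = Q.star ħ (f u) (f v)) ∧
        Q.star ħ (symbP 0) (symbP 1) = -Q.star ħ (symbP 1) (symbP 0) ∧
        (∀ a : Fin 2, Q.star ħ (symbP a) (symbP a) = 0)) ∧
      -- independence of `ħ` of the subalgebras generated by the `x_a` and by the `p_a`
      (∀ ħ ħ' : ℝ,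
        (genSubalg (Q.star ħ) (Set.range symbX) = genSubalg (Q.star ħ') (Set.range symbX) ∧
          ∀ u ∈ genSubalg (Q.star ħ) (Set.range symbX),
          ∀ v ∈ genSubalg (Q.star ħ) (Set.range symbX), Q.star ħ u v = Q.star ħ' u v) ∧
        (genSubalg (Q.star ħ) (Set.range symbP) = genSubalg (Q.star ħ') (Set.range symbP) ∧
          ∀ u ∈ genSubalg (Q.star ħ) (Set.range symbP),
          ∀ v ∈ genSubalg (Q.star ħ) (Set.range symbP), Q.star ħ u v = Q.star ħ' u v)) ∧
      -- the classical limit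
      (∀ u v : SymbAlg, Q.star 0 u v = symbMul u v) := by
  refine ⟨existsUnique_isInduced, fun Q hQ => ?_⟩
  rw [← Q.star_zero]
  refine ⟨fun ħ => ⟨fun a b => ?_, symbP_star_symbX hQ ħ, fun a b => ?_, fun a b => ?_,
    genSubalg_symbX_union_symbP hQ ħ, exists_opEquiv_genSubalg_symbX Q ħ,
    symbP_star_anticomm hQ ħ 0 1, symbP_star_self hQ ħ⟩,
    fun ħ ħ' => ⟨genSubalg_symbX_independent Q ħ ħ', genSubalg_symbP_independent hQ ħ ħ'⟩,
    fun _ _ => rfl⟩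
  · exact (posSymb_star Q ħ (unitQ a) 0 _).trans (posSymb_star Q 0 (unitQ a) 0 _).symm
  · exact (posSymb_star Q ħ (unitQ a) 1 _).trans (posSymb_star Q 0 (unitQ a) 1 _).symm
  · exact (symbP_star_symbP hQ ħ a b).trans (symbP_star_symbP hQ 0 a b).symm
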